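/- Let $(\mathbb K,\partial)$ be a differential field with field of constants $\Bbbk$, and write $\otimes=\otimes_{\Bbbk}$. Let $\mathcal H(\mathbb K)=\mathbb K^{\mathbb N}$ with the Hurwitz product $(\alpha\beta)(n)=\sum_{k=0}^n\binom nk\alpha(k)\beta(n-k)$ and the shift derivation $\mathcal N(\alpha)(n)=\alpha(n+1)$; it is a $(\mathbb K\otimes\mathbb K)$-algebra via $x\otimes y\mapsto s(x)t(y)$, where $s(x)=(x,0,0,\dots)$ and $t(x)=(\partial^n x)_{n\ge0}$. Let $\mathsf{Dlin}(\mathbb K)\subseteq\mathcal H(\mathbb K)$ be the set of all $\alpha$ with $\sum_{i=0}^d t(c_i)\mathcal N^i(\alpha)=0$ for some $d\ge0$ and $c_0,\dots,c_d\in\mathbb K$ with $c_d\neq0$. Let $U=\mathbb K[Y;\partial]=\bigoplus_{i\ge0}Y^i\mathbb K$ be the Ore extension with $xY=Yx+\partial(x)$ for $x\in\mathbb K$, with right $\mathbb K$-linear comultiplication $Y^n\mapsto\sum_k\binom nk Y^k\otimes_{\mathbb K}Y^{n-k}$ and counit $\varepsilon(Y^n)=\delta_{n,0}$. Let $U^*$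 be the convolution algebra of right $\mathbb K$-linear maps $U\to\mathbb K$; it is a $(\mathbb K\otimes\mathbb K)$-algebra via $x\otimes y\mapsto (x\varepsilon)*\mu(y)$ with $\mu(y)(Y^n)=\partial^n(y)$. A differential $\mathbb K$-vector space $(M,\partial_M)$ is a finite-dimensional right $\mathbb K$-vector space $M$ with an additive map $\partial_M$ satisfying $\partial_M(mx)=\partial_M(m)x+m\,\partial(x)$; it is a right $U$-module by $m\triangleleft Y=\partial_M(m)$. Let $T_M$ be its ring of endomorphisms and $$U^\circ=\Big(\bigoplus_{(M,\partial_M)}M^*\otimes_{T_M}M\Big)\Big/\big\langle\psi\otimes f(m)-\psi f\otimes m\big\rangle,$$ where $f:M\to N$ runs over all $\mathbb K$-linear maps with $f\partial_M=\partial_N f$, $\psi\in N^*$ and $m\in M$. Its multiplication is $\overline{\varphi\otimes p}\cdot\overline{\psi\otimes q}=\overline{(\psi\diamond\varphi)\otimes(q\otimes_{\mathbb K}p)}$ with $(\psi\diamond\varphi)(q\otimes_{\mathbb K} p)=\varphi(\psi(q)p)$, where $Q\otimes_{\mathbb K}P$ carries the differential $\partial_Q\otimes 1+1\otimes\partial_P$;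 its $(\mathbb K\otimes\mathbb K)$-algebra structure is $x\otimes y\mapsto\overline{x\otimes1}\cdot\overline{1\otimes y}$ (classes coming from the differential vector space $(\mathbb K,\partial)$, with $\mathbb K^*=\mathbb K$), and its derivation is $\partial_\circ(\overline{\varphi\otimes m})=\overline{\varphi\otimes\partial_M(m)}$. Let $\zeta:U^\circ\to U^*$ be the canonical map $\zeta(\overline{\varphi\otimes m})(u)=\varphi(m\triangleleft u)$. Theorem. The map $\Phi:U^*\to\mathcal H(\mathbb K)$, $f\mapsto(f(Y^n))_{n\ge0}$, is an isomorphism of $(\mathbb K\otimes\mathbb K)$-algebras, $\zeta$ is a morphism of $(\mathbb K\otimes\mathbb K)$-algebras, $\mathsf{Dlin}(\mathbb K)$ is a $(\mathbb K\otimes\mathbb K)$-subalgebra of $\mathcal H(\mathbb K)$, and $\Phi$ induces an isomorphism of $(\mathbb K\otimes\mathbb K)$-algebras $\phi:U^\circ\to\mathsf{Dlin}(\mathbb K)$ with $\phi=\Phi\circ\zeta$. Explicitly, $\phi(\overline{\varphi\otimes m})=(\varphi(\partial_M^n(m)))_{n\ge0}$. The inverse is given as follows: if $\alpha\in\mathsf{Dlin}(\mathbb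 K)$ and $\sum_{i=0}^d t(c_i)\mathcal N^i(\alpha)=0$ with $c_d\ne0$, put $P_\alpha=\sum_{i=0}^dY^ic_i$; then $M_\alpha=U/P_\alpha U$ is finite-dimensional over $\mathbb K$, hence a differential $\mathbb K$-vector space with differential the right action of $Y$, the map $f_\alpha=\Phi^{-1}(\alpha)$ induces a map $\tilde f_\alpha:M_\alpha\to\mathbb K$, and $\phi^{-1}(\alpha)=\overline{\tilde f_\alpha\otimes\bar1}$. Moreover $\mathcal N$ restricts to a derivation of $\mathsf{Dlin}(\mathbb K)$ that is $\mathbb K$-linear with respect to $s$, and $\phi\circ\partial_\circ=\mathcal N\circ\phi$, so that $\phi$ is an isomorphism of differential $\mathbb K$-algebras. -/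

import Mathlib

open scoped Differential TensorProduct DirectSum
open Finset.HasAntidiagonal (antidiagonal mem_antidiagonal)

universe u

namespace DRS

noncomputable section

/-! ## Hurwitz series over a field -/

/-- The set of sequences in `K`; it is given the Hurwitz product below. -/
@[ext]
structure Hurwitz (K : Type u) where
  /-- The terms of the sequence. -/
  coeff : ℕ → K

namespace Hurwitz

variable {K : Type u} [Field K]

instance : Zero (Hurwitz K) := ⟨⟨fun _ => 0⟩⟩
instance : One (Hurwitz K) := ⟨⟨fun n => if n = 0 then 1 else 0⟩⟩
instance : Add (Hurwitz K) := ⟨fun a b => ⟨fun n => a.coeff n + b.coeff n⟩⟩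
instance : Neg (Hurwitz K) := ⟨fun a => ⟨fun n => -a.coeff n⟩⟩

/-- The Hurwitz product `(a b)(n) = ∑_{k + l = n} (n choose k) a(k) b(l)`. -/
instance : Mul (Hurwitz K) :=
  ⟨fun a b => ⟨fun n =>
    ∑ p ∈ antidiagonal n, (n.choose p.1 : K) * (a.coeff p.1 * b.coeff p.2)⟩⟩

theorem zero_coeff (n : ℕ) : (0 : Hurwitz K).coeff n = 0 := rfl
theorem one_coeff (n : ℕ) : (1 : Hurwitz K).coeff n = if n = 0 then 1 else 0 := rfl
theorem add_coeff (a b : Hurwitz K) (n : ℕ) : (a + b).coeff n = a.coeff n + b.coeff n := rfl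
theorem neg_coeff (a : Hurwitz K) (n : ℕ) : (-a).coeff n = -a.coeff n := rfl
theorem mul_coeff (a b : Hurwitz K) (n : ℕ) : (a * b).coeff n =
    ∑ p ∈ antidiagonal n, (n.choose p.1 : K) * (a.coeff p.1 * b.coeff p.2) := rfl

theorem ext_coeff {a b : Hurwitz K} (h : ∀ n, a.coeff n = b.coeff n) : a = b :=
  Hurwitz.ext (funext h)

instance : AddCommGroup (Hurwitz K) where
  add_assoc a b c := ext_coeff fun n => add_assoc _ _ _
  zero_add a := ext_coeff fun n => zero_add _
  add_zero a := ext_coeff fun n => add_zero _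
  add_comm a b := ext_coeff fun n => add_comm _ _
  neg_add_cancel a := ext_coeff fun n => neg_add_cancel _
  nsmul := nsmulRec
  zsmul := zsmulRec

/-- The shift operator, as an additive map. -/
def shiftAdd : Hurwitz K →+ Hurwitz K where
  toFun a := ⟨fun n => a.coeff (n + 1)⟩
  map_zero' := rfl
  map_add' _ _ := rfl

theorem shiftAdd_coeff (a : Hurwitz K) (n : ℕ) : (shiftAdd a).coeff n = a.coeff (n + 1) := rfl

theorem ext_shift {a b : Hurwitz K} (h0 : a.coeff 0 = b.coeff 0)
    (h : shiftAdd a = shiftAdd b) : a = b :=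
  ext_coeff fun n => by
    cases n with
    | zero => exact h0
    | succ n => rw [← shiftAdd_coeff, h, shiftAdd_coeff]

theorem shiftAdd_one : shiftAdd (1 : Hurwitz K) = 0 := ext_coeff fun n => by
  rw [shiftAdd_coeff, one_coeff, if_neg (Nat.succ_ne_zero n), zero_coeff]

theorem mul_coeff_zero (a b : Hurwitz K) : (a * b).coeff 0 = a.coeff 0 * b.coeff 0 := by
  simp [mul_coeff]

theorem shiftAdd_mul (a b : Hurwitz K) :
    shiftAdd (a * b) = shiftAdd a * b + a * shiftAdd b := ext_coeff fun n => by
  rw [shiftAdd_coeff, mul_coeff,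
    Finset.sum_antidiagonal_choose_succ_mul (fun i j => a.coeff i * b.coeff j) n, add_coeff,
    mul_coeff, mul_coeff, add_comm]
  congr 1
  refine Finset.sum_congr rfl fun p hp => ?_
  rw [mem_antidiagonal] at hp
  rw [← hp, Nat.choose_symm_add, shiftAdd_coeff]

theorem add_mul_aux (a b c : Hurwitz K) : (a + b) * c = a * c + b * c :=
  ext_coeff fun n => by
    simp only [mul_coeff, add_coeff, ← Finset.sum_add_distrib]
    exact Finset.sum_congr rfl fun p _ => by ring

theorem zero_mul_aux (a : Hurwitz K) : 0 * a = 0 := ext_coeff fun n => by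
  simp [mul_coeff, zero_coeff]

theorem mul_comm_aux (a b : Hurwitz K) : a * b = b * a := ext_coeff fun n => by
  induction n generalizing a b with
  | zero => rw [mul_coeff_zero, mul_coeff_zero, mul_comm]
  | succ n ih =>
    rw [← shiftAdd_coeff, ← shiftAdd_coeff, shiftAdd_mul, shiftAdd_mul, add_coeff, add_coeff,
      ih, ih a, add_comm]

theorem mul_assoc_aux (a b c : Hurwitz K) : a * b * c = a * (b * c) := ext_coeff fun n => by
  induction n generalizing a b c with
  | zero => simp only [mul_coeff_zero, mul_assoc]
  | succ n ih =>
    rw [← shiftAdd_coeff, ← shiftAdd_coeff, shiftAdd_mul, shiftAdd_mul, shiftAdd_mul a (b * c),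
      shiftAdd_mul b c, add_mul_aux, mul_comm_aux a (_ + _), add_mul_aux, mul_comm_aux _ a,
      mul_comm_aux _ a]
    simp only [add_coeff, ih, add_assoc]

theorem one_mul_aux (a : Hurwitz K) : 1 * a = a := ext_coeff fun n => by
  induction n generalizing a with
  | zero => rw [mul_coeff_zero, one_coeff, if_pos rfl, one_mul]
  | succ n ih =>
    rw [← shiftAdd_coeff, ← shiftAdd_coeff, shiftAdd_mul, shiftAdd_one, zero_mul_aux, zero_add, ih]

instance : CommRing (Hurwitz K) where
  mul_assoc := mul_assoc_aux
  one_mul := one_mul_aux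
  mul_one a := by rw [mul_comm_aux, one_mul_aux]
  mul_comm := mul_comm_aux
  left_distrib a b c := by rw [mul_comm_aux, add_mul_aux, mul_comm_aux b, mul_comm_aux c]
  right_distrib := add_mul_aux
  zero_mul := zero_mul_aux
  mul_zero a := by rw [mul_comm_aux, zero_mul_aux]
  zsmul := zsmulRec
  neg_add_cancel := neg_add_cancel

theorem shiftAdd_single (x : K) :
    shiftAdd (⟨fun n => if n = 0 then x else 0⟩ : Hurwitz K) = 0 :=
  ext_coeff fun n => by
    rw [shiftAdd_coeff, zero_coeff]
    dsimp only
    rw [if_neg (Nat.succ_ne_zero n)]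

/-- The source map `s : x ↦ (x, 0, 0, …)`. -/
def source (K : Type u) [Field K] : K →+* Hurwitz K where
  toFun x := ⟨fun n => if n = 0 then x else 0⟩
  map_one' := rfl
  map_zero' := ext_coeff fun n => ite_self 0
  map_add' x y := ext_coeff fun n => by rw [add_coeff]; dsimp only; split_ifs <;> simp
  map_mul' x y := by
    refine ext_shift ?_ ?_
    · rw [mul_coeff_zero]; rfl
    · rw [shiftAdd_mul, shiftAdd_single, shiftAdd_single, shiftAdd_single, zero_mul, mul_zero,
        add_zero]

theorem source_coeff (x : K) (n : ℕ) : (source K x).coeff n = if n = 0 then x else 0 := rfl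

theorem shiftAdd_source (x : K) : shiftAdd (source K x) = 0 := shiftAdd_single x

/-- `Hurwitz K` is a `K`-algebra through the source map. -/
instance : Algebra K (Hurwitz K) := (source K).toAlgebra

theorem algebraMap_eq : algebraMap K (Hurwitz K) = source K := rfl

theorem smul_coeff (x : K) (a : Hurwitz K) (n : ℕ) : (x • a).coeff n = x * a.coeff n := by
  rw [Algebra.smul_def, algebraMap_eq]
  induction n generalizing a with
  | zero => rw [mul_coeff_zero]; rfl
  | succ n ih =>
    rw [← shiftAdd_coeff, shiftAdd_mul, shiftAdd_source, zero_mul, zero_add, ih, shiftAdd_coeff]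

/-- The derivation `𝒩` of `Hurwitz K`: the shift `𝒩(a)(n) = a(n + 1)`. -/
def shift (K : Type u) [Field K] : Derivation K (Hurwitz K) (Hurwitz K) :=
  Derivation.mk'
    { toFun := fun a => shiftAdd a
      map_add' := map_add _
      map_smul' := fun x a => ext_coeff fun n => by
        rw [RingHom.id_apply, smul_coeff, shiftAdd_coeff, shiftAdd_coeff, smul_coeff] }
    (fun a b => by
      rw [LinearMap.coe_mk, AddHom.coe_mk, smul_eq_mul, smul_eq_mul, shiftAdd_mul, add_comm,
        mul_comm b])

theorem shift_coeff (a : Hurwitz K) (n : ℕ) : (shift K a).coeff n = a.coeff (n + 1) := rfl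

end Hurwitz

/-! ## The differential field and its constants

A differential field is a field `K` with Mathlib's `Differential K`; `x′` is the derivative. -/

/-- The subfield of constants of a differential field `K`. -/
def constants (K : Type u) [Field K] [Differential K] : Subfield K where
  carrier := {c | c′ = 0}
  mul_mem' := by
    intro a b ha hb
    simp only [Set.mem_ofPred_eq] at *
    simp [Derivation.leibniz, ha, hb]
  one_mem' := by simp
  add_mem' := by
    intro a b ha hb
    simp only [Set.mem_ofPred_eq] at *
    simp [ha, hb]
  zero_mem' := by simp
  neg_mem' := by
    intro a ha
    simp only [Set.mem_ofPred_eq] at *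
    simp [ha]
  inv_mem' := by
    intro a ha
    simp only [Set.mem_ofPred_eq] at *
    simp [Derivation.leibniz_inv, ha]

variable {K : Type u} [Field K] [Differential K]

theorem deriv_const (c : constants K) : ((c : K))′ = 0 := c.2

/-- A commutative `K`-algebra `A` (structure map `s`) with a second ring map `t : K → A` agreeing
with `s` on constants is a `(K ⊗ K)`-algebra (tensor over the constants), `x ⊗ y ↦ s x * t y`. -/
def twoSided {A : Type*} [CommRing A] [Algebra K A] (t : K →+* A)
    (ht : ∀ c : constants K, t c = algebraMap K A c) : K ⊗[constants K] K →+* A :=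
  letI : Algebra (constants K) A := Algebra.compHom A (algebraMap (constants K) K)
  (Algebra.TensorProduct.productMap
    (⟨algebraMap K A, fun _ => rfl⟩ : K →ₐ[constants K] A)
    (⟨t, ht⟩ : K →ₐ[constants K] A)).toRingHom

theorem twoSided_tmul {A : Type*} [CommRing A] [Algebra K A] (t : K →+* A)
    (ht : ∀ c : constants K, t c = algebraMap K A c) (x y : K) :
    twoSided t ht (x ⊗ₜ y) = algebraMap K A x * t y := by
  let : Algebra (constants K) A := Algebra.compHom A (algebraMap (constants K) K)
  exact Algebra.TensorProduct.productMap_apply_tmul _ _ _ _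

theorem twoSided_smul {A : Type*} [CommRing A] [Algebra K A] (t : K →+* A)
    (ht : ∀ c : constants K, t c = algebraMap K A c) (x : K) (z : K ⊗[constants K] K) :
    twoSided t ht (x • z) = algebraMap K A x * twoSided t ht z := by
  induction z using TensorProduct.induction_on with
  | zero => rw [smul_zero, map_zero, mul_zero]
  | add a b ha hb => rw [smul_add, map_add, map_add, ha, hb, mul_add]
  | tmul a b =>
    rw [TensorProduct.smul_tmul', twoSided_tmul, twoSided_tmul, smul_eq_mul, map_mul, mul_assoc]

/-! ## Differentially recursive sequences -/

namespace Hurwitz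

/-- The target map `t : x ↦ (∂ⁿ x)ₙ`. -/
def target (K : Type u) [Field K] [Differential K] : K →+* Hurwitz K where
  toFun x := ⟨fun n => (Differential.deriv : K → K)^[n] x⟩
  map_one' := by
    refine ext_shift rfl ?_
    rw [shiftAdd_one]
    refine ext_coeff fun n => ?_
    rw [shiftAdd_coeff, zero_coeff]
    dsimp only
    rw [Function.iterate_succ_apply, Derivation.map_one_eq_zero]
    exact iterate_map_zero _ n
  map_zero' := ext_coeff fun n => iterate_map_zero _ n
  map_add' x y := ext_coeff fun n => iterate_map_add _ n x y
  map_mul' x y := ext_coeff fun n => by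
    dsimp only
    induction n generalizing x y with
    | zero => rw [mul_coeff_zero]; rfl
    | succ n ih =>
      have h : ∀ z : K, shiftAdd (⟨fun n => (Differential.deriv : K → K)^[n] z⟩ : Hurwitz K)
          = ⟨fun n => (Differential.deriv : K → K)^[n] (z′)⟩ := fun z => rfl
      rw [← shiftAdd_coeff, shiftAdd_mul, h, h, add_coeff, ← ih, ← ih,
        Function.iterate_succ_apply,
        Derivation.leibniz, iterate_map_add, smul_eq_mul, smul_eq_mul, add_comm, mul_comm y]

theorem target_coeff (x : K) (n : ℕ) :
    (target K x).coeff n = (Differential.deriv : K → K)^[n] x := rfl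

theorem target_const (c : constants K) : target K c = algebraMap K (Hurwitz K) c :=
  ext_coeff fun n => by
    rw [algebraMap_eq, target_coeff, source_coeff]
    cases n with
    | zero => rfl
    | succ n =>
      rw [Function.iterate_succ_apply, deriv_const, iterate_map_zero, if_neg (Nat.succ_ne_zero n)]

/-- The `(K ⊗ K)`-algebra structure `x ⊗ y ↦ s x * t y` of `Hurwitz K`. -/
instance : Algebra (K ⊗[constants K] K) (Hurwitz K) :=
  (twoSided (target K) target_const).toAlgebra

instance : IsScalarTower K (K ⊗[constants K] K) (Hurwitz K) where
  smul_assoc x z a := by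
    rw [Algebra.smul_def (x • z) a, Algebra.smul_def x (z • a), Algebra.smul_def z a, ← mul_assoc]
    exact congrArg (· * a) (twoSided_smul (target K) target_const x z)

/-- The operator `∑_{i ≤ d} t(cᵢ) 𝒩ⁱ` applied to a sequence `a`. -/
def operator (d : ℕ) (c : ℕ → K) (a : Hurwitz K) : Hurwitz K :=
  ∑ i ∈ Finset.range (d + 1), target K (c i) * (shift K)^[i] a

end Hurwitz

/-- The set of differentially recursive sequences: those killed by an operator
`∑_{i ≤ d} t(cᵢ) 𝒩ⁱ` with `c_d ≠ 0`. -/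
def Dlin (K : Type u) [Field K] [Differential K] : Set (Hurwitz K) :=
  {a | ∃ (d : ℕ) (c : ℕ → K), c d ≠ 0 ∧ Hurwitz.operator d c a = 0}

/-! ## The ring of differential operators `U = K[Y; ∂]` -/

/-- The Ore extension `U = ⨁ Yⁱ K`; the finitely supported function `c` stands for `∑ Yⁱ cᵢ`. -/
def DiffOp (K : Type u) [Field K] : Type u := ℕ →₀ K

namespace DiffOp

instance : AddCommGroup (DiffOp K) := inferInstanceAs (AddCommGroup (ℕ →₀ K))

/-- The *right* `K`-vector space structure, `(∑ Yⁱ cᵢ) x = ∑ Yⁱ (cᵢ x)`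
(`K` is commutative, so it is written on the left). -/
instance : Module K (DiffOp K) := inferInstanceAs (Module K (ℕ →₀ K))

/-- The element `Yⁿ c`. -/
def mono (n : ℕ) (c : K) : DiffOp K := Finsupp.single n c

/-- The basis `(Yⁿ)ₙ` of the right `K`-vector space `U`. -/
def basis (K : Type u) [Field K] : Module.Basis ℕ K (DiffOp K) :=
  Module.Basis.ofRepr (LinearEquiv.refl K (ℕ →₀ K))

theorem basis_apply (n : ℕ) : basis K n = mono n 1 := rfl

theorem smul_mono (x : K) (n : ℕ) (c : K) : x • mono n c = mono n (x * c) :=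
  Finsupp.smul_single x n c

theorem mono_zero (n : ℕ) : mono n (0 : K) = 0 := Finsupp.single_zero n

theorem mono_add (n : ℕ) (c c' : K) : mono n (c + c') = mono n c + mono n c' :=
  Finsupp.single_add n c c'

/-- Additive maps out of `U` from their values on the `Yⁿ c`. -/
def liftAdd {A : Type*} [AddCommGroup A] (f : ℕ → K →+ A) : DiffOp K →+ A :=
  Finsupp.liftAddHom f

theorem liftAdd_mono {A : Type*} [AddCommGroup A] (f : ℕ → K →+ A) (n : ℕ) (c : K) :
    liftAdd f (mono n c) = f n c := Finsupp.liftAddHom_apply_single f n c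

theorem addHom_ext {A : Type*} [AddCommGroup A] {f g : DiffOp K →+ A}
    (h : ∀ n c, f (mono n c) = g (mono n c)) : f = g := Finsupp.addHom_ext h

/-- Right multiplication by `Y`: `Yⁿ c ↦ Yⁿ⁺¹ c + Yⁿ ∂c`. -/
def rightY (K : Type u) [Field K] [Differential K] : DiffOp K →+ DiffOp K :=
  liftAdd fun n =>
    { toFun := fun c => mono (n + 1) c + mono n c′
      map_zero' := by rw [map_zero, mono_zero, mono_zero, add_zero]
      map_add' := fun a b => by simp only [mono_add, map_add]; abel }

theorem rightY_mono (n : ℕ) (c : K) : rightY K (mono n c) = mono (n + 1) c + mono n c′ :=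
  liftAdd_mono _ n c

/-- Right multiplication by `Q = ∑ Yᵐ bₘ`: apply `rightY` `m` times, then multiply by `bₘ`. -/
def rightMul : DiffOp K →+ (DiffOp K →+ DiffOp K) :=
  liftAdd fun m =>
    { toFun := fun b =>
        { toFun := fun u => b • (rightY K)^[m] u
          map_zero' := by rw [iterate_map_zero, smul_zero]
          map_add' := fun u v => by rw [iterate_map_add, smul_add] }
      map_zero' := by ext u; exact zero_smul K _
      map_add' := fun a b => by ext u; exact add_smul a b _ }

theorem rightMul_mono (m : ℕ) (b : K) (u : DiffOp K) :
    rightMul (mono m b) u = b • (rightY K)^[m] u :=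
  DFunLike.congr_fun (liftAdd_mono _ m b) u

instance : Mul (DiffOp K) := ⟨fun P Q => rightMul Q P⟩

theorem mul_def (P Q : DiffOp K) : P * Q = rightMul Q P := rfl

instance : One (DiffOp K) := ⟨mono 0 1⟩

theorem one_def : (1 : DiffOp K) = mono 0 1 := rfl

theorem rightY_smul (x : K) (u : DiffOp K) :
    rightY K (x • u) = x • rightY K u + x′ • u := by
  have : (rightY K).comp (DistribSMul.toAddMonoidHom (DiffOp K) x) =
      (DistribSMul.toAddMonoidHom (DiffOp K) x).comp (rightY K) +
        DistribSMul.toAddMonoidHom (DiffOp K) x′ := addHom_ext fun n c => by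
    change rightY K (x • mono n c) = x • rightY K (mono n c) + x′ • mono n c
    simp only [rightY_mono, smul_mono, smul_add, Derivation.leibniz, mono_add, smul_eq_mul,
      mul_comm c]
    abel
  exact DFunLike.congr_fun this u

theorem rightMul_rightY (Q u : DiffOp K) :
    rightMul (rightY K Q) u = rightY K (rightMul Q u) := by
  have : (AddMonoidHom.eval u).comp (rightMul.comp (rightY K)) =
      (rightY K).comp ((AddMonoidHom.eval u).comp rightMul) := addHom_ext fun n c => by
    change rightMul (rightY K (mono n c)) u = rightY K (rightMul (mono n c) u)
    rw [rightY_mono, map_add, AddMonoidHom.add_apply, rightMul_mono, rightMul_mono, rightMul_mono,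
      rightY_smul, Function.iterate_succ_apply']
  exact DFunLike.congr_fun this Q

theorem rightMul_smul (x : K) (Q u : DiffOp K) :
    rightMul (x • Q) u = x • rightMul Q u := by
  have : (AddMonoidHom.eval u).comp (rightMul.comp (DistribSMul.toAddMonoidHom (DiffOp K) x)) =
      (DistribSMul.toAddMonoidHom (DiffOp K) x).comp ((AddMonoidHom.eval u).comp rightMul) :=
    addHom_ext fun n c => by
      change rightMul (x • mono n c) u = x • rightMul (mono n c) u
      rw [smul_mono, rightMul_mono, rightMul_mono, mul_smul]
  exact DFunLike.congr_fun this Q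

theorem mul_assoc_aux (P Q R : DiffOp K) : P * Q * R = P * (Q * R) := by
  simp only [mul_def]
  have : (AddMonoidHom.eval (rightMul Q P)).comp rightMul =
      (AddMonoidHom.eval P).comp (rightMul.comp ((AddMonoidHom.eval Q).comp rightMul)) :=
    addHom_ext fun n c => by
      change rightMul (mono n c) (rightMul Q P) = rightMul (rightMul (mono n c) Q) P
      rw [rightMul_mono, rightMul_mono, rightMul_smul]
      congr 1
      induction n with
      | zero => rfl
      | succ n ih =>
        rw [Function.iterate_succ_apply', Function.iterate_succ_apply', ih, rightMul_rightY]
  exact DFunLike.congr_fun this R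

theorem rightY_pow_one (n : ℕ) : (rightY K)^[n] (mono 0 1) = mono n 1 := by
  induction n with
  | zero => rfl
  | succ n ih =>
    rw [Function.iterate_succ_apply', ih, rightY_mono, Derivation.map_one_eq_zero, mono_zero,
      add_zero]

theorem one_mul_aux (P : DiffOp K) : 1 * P = P := by
  have : (AddMonoidHom.eval (1 : DiffOp K)).comp rightMul = AddMonoidHom.id (DiffOp K) :=
    addHom_ext fun n c => by
      change rightMul (mono n c) (mono 0 1) = mono n c
      rw [rightMul_mono, rightY_pow_one, smul_mono, mul_one]
  exact DFunLike.congr_fun this P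

instance : Ring (DiffOp K) :=
  { (inferInstance : AddCommGroup (DiffOp K)) with
    mul := (· * ·)
    one := 1
    mul_assoc := mul_assoc_aux
    one_mul := one_mul_aux
    mul_one := fun P => by
      rw [one_def, mul_def, rightMul_mono, one_smul]; rfl
    left_distrib := fun a b c => by simp only [mul_def, map_add, AddMonoidHom.add_apply]
    right_distrib := fun a b c => by simp only [mul_def, map_add]
    zero_mul := fun a => by simp only [mul_def, map_zero]
    mul_zero := fun a => by simp only [mul_def, map_zero]; rfl }

/-- The generator `Y`. -/
def Y (K : Type u) [Field K] : DiffOp K := mono 1 1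

/-- The inclusion `K → U`, `x ↦ Y⁰ x`. -/
def incl (K : Type u) [Field K] [Differential K] : K →+* DiffOp K where
  toFun x := mono 0 x
  map_one' := rfl
  map_zero' := Finsupp.single_zero 0
  map_add' := mono_add 0
  map_mul' x y := by
    rw [mul_def, rightMul_mono, Function.iterate_zero_apply]
    rw [smul_mono, mul_comm]

/-- The differential operator `∑_{i ≤ d} Yⁱ cᵢ`. -/
def ofCoeffs (d : ℕ) (c : ℕ → K) : DiffOp K :=
  ∑ i ∈ Finset.range (d + 1), Y K ^ i * incl K (c i)

/-- The `K`-action on `U` is right multiplication by scalars. -/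
theorem smul_eq_mul_incl (x : K) (u : DiffOp K) : x • u = u * incl K x := by
  change _ = rightMul (mono 0 x) u
  rw [rightMul_mono]; rfl

theorem mul_Y (u : DiffOp K) : u * Y K = rightY K u := by
  change rightMul (mono 1 1) u = _
  rw [rightMul_mono, one_smul, Function.iterate_one]

theorem Y_pow (n : ℕ) : Y K ^ n = mono n 1 := by
  induction n with
  | zero => rfl
  | succ n ih =>
    rw [pow_succ, ih, mul_Y, rightY_mono, Derivation.map_one_eq_zero, mono_zero, add_zero]

theorem mono_eq (n : ℕ) (c : K) : mono n c = Y K ^ n * incl K c := by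
  rw [← smul_eq_mul_incl, Y_pow, smul_mono, mul_one]

/-- The defining relation `x Y = Y x + ∂(x)` of the Ore extension. -/
theorem incl_mul_Y (x : K) : incl K x * Y K = Y K * incl K x + incl K x′ := by
  rw [mul_Y, ← smul_eq_mul_incl]
  change rightY K (mono 0 x) = x • mono 1 1 + mono 0 x′
  rw [rightY_mono, smul_mono, mul_one]

theorem mul_smul' (x : K) (P u : DiffOp K) : P * (x • u) = x • (P * u) := by
  rw [smul_eq_mul_incl, smul_eq_mul_incl, mul_assoc]

/-- Left multiplication by `P`, a right `K`-linear map. -/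
def lmul (P : DiffOp K) : DiffOp K →ₗ[K] DiffOp K where
  toFun u := P * u
  map_add' := mul_add P
  map_smul' x u := mul_smul' x P u

/-- The comultiplication of `U`: the right `K`-linear map with
`Yⁿ ↦ ∑_{k + l = n} (n choose k) Yᵏ ⊗ Yˡ`; in `U ⊗[K] U` both factors carry the right
`K`-action. -/
def comulMap (K : Type u) [Field K] [Differential K] :
    DiffOp K →ₗ[K] DiffOp K ⊗[K] DiffOp K :=
  (basis K).constr K fun n =>
    ∑ p ∈ antidiagonal n, n.choose p.1 • ((Y K ^ p.1) ⊗ₜ[K] (Y K ^ p.2))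

theorem comulMap_Y_pow (n : ℕ) : comulMap K (Y K ^ n) =
    ∑ p ∈ antidiagonal n, n.choose p.1 • ((Y K ^ p.1) ⊗ₜ[K] (Y K ^ p.2)) := by
  rw [Y_pow, ← basis_apply]
  exact (basis K).constr_basis K _ n

/-- The counit of `U`: the right `K`-linear map with `Yⁿ ↦ δ_{0,n}`. -/
def counitMap (K : Type u) [Field K] [Differential K] : DiffOp K →ₗ[K] K :=
  (basis K).constr K fun n => if n = 0 then 1 else 0

theorem counitMap_Y_pow (n : ℕ) : counitMap K (Y K ^ n) = if n = 0 then 1 else 0 := by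
  rw [Y_pow, ← basis_apply]
  exact (basis K).constr_basis K _ n

theorem hom_ext {A : Type*} [AddCommGroup A] [Module K A] {f g : DiffOp K →ₗ[K] A}
    (h : ∀ n, f (Y K ^ n) = g (Y K ^ n)) : f = g :=
  (basis K).ext fun n => by rw [basis_apply, ← Y_pow]; exact h n

theorem comul_Y_mul (u : DiffOp K) : comulMap K (Y K * u) =
    (lmul (Y K)).rTensor (DiffOp K) (comulMap K u) +
      (lmul (Y K)).lTensor (DiffOp K) (comulMap K u) := by
  have : comulMap K ∘ₗ lmul (Y K) = (lmul (Y K)).rTensor (DiffOp K) ∘ₗ comulMap K +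
      (lmul (Y K)).lTensor (DiffOp K) ∘ₗ comulMap K := hom_ext fun n => by
    change comulMap K (Y K * Y K ^ n) = (lmul (Y K)).rTensor (DiffOp K) (comulMap K (Y K ^ n)) +
      (lmul (Y K)).lTensor (DiffOp K) (comulMap K (Y K ^ n))
    rw [← pow_succ', comulMap_Y_pow, comulMap_Y_pow,
      Finset.sum_antidiagonal_choose_succ_nsmul
        (fun i j => (Y K ^ i) ⊗ₜ[K] (Y K ^ j)) n, add_comm, map_sum, map_sum]
    congr 1
    · refine Finset.sum_congr rfl fun p hp => ?_
      rw [mem_antidiagonal] at hp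
      rw [← hp, Nat.choose_symm_add, map_nsmul, LinearMap.rTensor_tmul, pow_succ' _ p.1]
      rfl
    · refine Finset.sum_congr rfl fun p _ => ?_
      rw [map_nsmul, LinearMap.lTensor_tmul, pow_succ' _ p.2]
      rfl
  exact LinearMap.congr_fun this u

theorem comul_one : comulMap K 1 = (1 : DiffOp K) ⊗ₜ[K] (1 : DiffOp K) := by
  have := comulMap_Y_pow (K := K) 0
  simpa using this

theorem counit_one : counitMap K 1 = 1 := by
  have := counitMap_Y_pow (K := K) 0
  simpa using this

theorem counit_Y_mul (u : DiffOp K) : counitMap K (Y K * u) = 0 := by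
  have : counitMap K ∘ₗ lmul (Y K) = 0 := hom_ext fun n => by
    change counitMap K (Y K * Y K ^ n) = 0
    rw [← pow_succ', counitMap_Y_pow, if_neg (Nat.succ_ne_zero n)]
  exact LinearMap.congr_fun this u

theorem coassoc_aux₁ (w : DiffOp K ⊗[K] DiffOp K) :
    TensorProduct.assoc K _ _ _ ((comulMap K).rTensor _ ((lmul (Y K)).rTensor _ w)) =
      (lmul (Y K)).rTensor _ (TensorProduct.assoc K _ _ _ ((comulMap K).rTensor _ w)) +
        ((lmul (Y K)).rTensor (DiffOp K)).lTensor (DiffOp K)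
          (TensorProduct.assoc K _ _ _ ((comulMap K).rTensor _ w)) := by
  induction w with
  | zero => simp
  | add x y hx hy => simp only [map_add, hx, hy]; abel
  | tmul u v =>
    rw [LinearMap.rTensor_tmul, LinearMap.rTensor_tmul, LinearMap.rTensor_tmul]
    change TensorProduct.assoc K _ _ _ (comulMap K (Y K * u) ⊗ₜ[K] v) = _
    rw [comul_Y_mul, TensorProduct.add_tmul, map_add]
    generalize comulMap K u = z
    induction z with
    | zero => simp
    | add x y hx hy =>
      simp only [map_add, TensorProduct.add_tmul] at hx hy ⊢
      rw [add_add_add_comm, hx, hy]; abel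
    | tmul a b => simp

theorem coassoc_aux₂ (w : DiffOp K ⊗[K] DiffOp K) :
    TensorProduct.assoc K _ _ _ ((comulMap K).rTensor _ ((lmul (Y K)).lTensor _ w)) =
      ((lmul (Y K)).lTensor (DiffOp K)).lTensor (DiffOp K)
          (TensorProduct.assoc K _ _ _ ((comulMap K).rTensor _ w)) := by
  induction w with
  | zero => simp
  | add x y hx hy => simp only [map_add, hx, hy]
  | tmul u v =>
    rw [LinearMap.lTensor_tmul, LinearMap.rTensor_tmul, LinearMap.rTensor_tmul]
    generalize comulMap K u = z
    induction z with
    | zero => simp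
    | add x y hx hy =>
      simp only [map_add, TensorProduct.add_tmul] at hx hy ⊢
      rw [hx, hy]
    | tmul a b => simp

theorem coassoc_aux₃ (w : DiffOp K ⊗[K] DiffOp K) :
    (comulMap K).lTensor _ ((lmul (Y K)).rTensor _ w) =
      (lmul (Y K)).rTensor _ ((comulMap K).lTensor _ w) := by
  induction w with
  | zero => simp
  | add x y hx hy => simp only [map_add, hx, hy]
  | tmul u v => simp

theorem coassoc_aux₄ (w : DiffOp K ⊗[K] DiffOp K) :
    (comulMap K).lTensor _ ((lmul (Y K)).lTensor _ w) =
      ((lmul (Y K)).rTensor (DiffOp K)).lTensor (DiffOp K) ((comulMap K).lTensor _ w) +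
      ((lmul (Y K)).lTensor (DiffOp K)).lTensor (DiffOp K) ((comulMap K).lTensor _ w) := by
  induction w with
  | zero => simp
  | add x y hx hy => simp only [map_add, hx, hy]; abel
  | tmul u v =>
    simp only [LinearMap.lTensor_tmul]
    change u ⊗ₜ[K] comulMap K (Y K * v) = _
    rw [comul_Y_mul, TensorProduct.tmul_add]

/-- The `K`-coalgebra structure of `U`. -/
instance : Coalgebra K (DiffOp K) where
  comul := comulMap K
  counit := counitMap K
  coassoc := hom_ext fun n => by
    simp only [LinearMap.comp_apply, LinearEquiv.coe_coe]
    induction n with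
    | zero => simp [comul_one]
    | succ n ih =>
      rw [pow_succ', comul_Y_mul]
      simp only [map_add, coassoc_aux₁, coassoc_aux₂, coassoc_aux₃, coassoc_aux₄, ih]
      abel
  rTensor_counit_comp_comul := hom_ext fun n => by
    simp only [LinearMap.comp_apply]
    induction n with
    | zero => simp [comul_one, counit_one]
    | succ n ih =>
      have h₁ : ∀ w, (counitMap K).rTensor (DiffOp K) ((lmul (Y K)).rTensor _ w) = 0 := fun w => by
        induction w with
        | zero => simp
        | add x y hx hy => simp only [map_add, hx, hy, add_zero]
        | tmul u v =>
          rw [LinearMap.rTensor_tmul, LinearMap.rTensor_tmul]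
          change counitMap K (Y K * u) ⊗ₜ[K] v = 0
          rw [counit_Y_mul, TensorProduct.zero_tmul]
      have h₂ : ∀ w, (counitMap K).rTensor (DiffOp K) ((lmul (Y K)).lTensor _ w) =
          (lmul (Y K)).lTensor _ ((counitMap K).rTensor (DiffOp K) w) := fun w => by
        induction w with
        | zero => simp
        | add x y hx hy => simp only [map_add, hx, hy]
        | tmul u v => simp
      rw [pow_succ', comul_Y_mul, map_add, h₁, h₂, ih, zero_add]
      rfl
  lTensor_counit_comp_comul := hom_ext fun n => by
    simp only [LinearMap.comp_apply]
    induction n with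
    | zero => simp [comul_one, counit_one]
    | succ n ih =>
      have h₁ : ∀ w, (counitMap K).lTensor (DiffOp K) ((lmul (Y K)).lTensor _ w) = 0 := fun w => by
        induction w with
        | zero => simp
        | add x y hx hy => simp only [map_add, hx, hy, add_zero]
        | tmul u v =>
          rw [LinearMap.lTensor_tmul, LinearMap.lTensor_tmul]
          change u ⊗ₜ[K] counitMap K (Y K * v) = 0
          rw [counit_Y_mul, TensorProduct.tmul_zero]
      have h₂ : ∀ w, (counitMap K).lTensor (DiffOp K) ((lmul (Y K)).rTensor _ w) =
          (lmul (Y K)).rTensor _ ((counitMap K).lTensor (DiffOp K) w) := fun w => by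
        induction w with
        | zero => simp
        | add x y hx hy => simp only [map_add, hx, hy]
        | tmul u v => simp
      rw [pow_succ', comul_Y_mul, map_add, h₁, h₂, ih, add_zero]
      rfl

theorem comul_Y_pow (n : ℕ) : CoalgebraStruct.comul (R := K) (Y K ^ n) =
    ∑ p ∈ antidiagonal n, n.choose p.1 • ((Y K ^ p.1) ⊗ₜ[K] (Y K ^ p.2)) :=
  comulMap_Y_pow n

instance : Coalgebra.IsCocomm K (DiffOp K) where
  comm_comp_comul := hom_ext fun n => by
    rw [LinearMap.comp_apply, comul_Y_pow, map_sum, ← Finset.Nat.sum_antidiagonal_swap]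
    refine Finset.sum_congr rfl fun p hp => ?_
    rw [mem_antidiagonal] at hp
    rw [map_nsmul, LinearEquiv.coe_coe, TensorProduct.comm_tmul, Prod.fst_swap, Prod.snd_swap,
      ← hp, Nat.choose_symm_add]

end DiffOp

/-! ## Differential modules -/

/-- A differential module over `K`: a finite-dimensional `K`-vector space `M` with an additive
map `∂` such that `∂(m x) = ∂(m) x + m ∂(x)` (such a map is linear over the constants). -/
structure DiffMod (K : Type u) [Field K] [Differential K] where
  /-- The underlying vector space. -/
  carrier : Type u
  [addCommGroup : AddCommGroup carrier]
  [module : Module K carrier]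
  [finite : Module.Finite K carrier]
  /-- The differential `∂` of `M`. -/
  der : carrier →+ carrier
  leibniz : ∀ (x : K) (m : carrier), der (x • m) = x • der m + x′ • m

namespace DiffMod

instance : CoeSort (DiffMod K) (Type u) := ⟨carrier⟩

attribute [instance] addCommGroup module finite

/-- The right action of `U` on `M`, `m ◁ ∑ Yⁱ cᵢ = ∑ ∂ⁱ(m) cᵢ`. -/
def act (M : DiffMod K) (m : M) : DiffOp K →ₗ[K] M :=
  (DiffOp.basis K).constr K fun n => M.der^[n] m

theorem act_Y_pow (M : DiffMod K) (m : M) (n : ℕ) :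
    M.act m (DiffOp.Y K ^ n) = M.der^[n] m := by
  rw [DiffOp.Y_pow, ← DiffOp.basis_apply]
  exact (DiffOp.basis K).constr_basis K _ n

/-- The differential maps `M → N`. -/
def IsHom (M N : DiffMod K) (f : M →ₗ[K] N) : Prop := ∀ m, f (M.der m) = N.der (f m)

/-- The differential module `(K, ∂)`. -/
abbrev unit (K : Type u) [Field K] [Differential K] : DiffMod K where
  carrier := K
  der := (Differential.deriv : Derivation ℤ K K).toLinearMap.toAddMonoidHom
  leibniz x m := by
    change (x * m)′ = x * m′ + x′ * m
    rw [Derivation.leibniz, smul_eq_mul, smul_eq_mul, mul_comm m]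

/-- The differential `n ⊗ m ↦ ∂n ⊗ m + n ⊗ ∂m` of a tensor product. -/
def tensorDer (N M : DiffMod K) : N ⊗[K] M →+ N ⊗[K] M :=
  TensorProduct.liftAddHom
    (AddMonoidHom.mk' (fun n => AddMonoidHom.mk' (fun m => N.der n ⊗ₜ[K] m + n ⊗ₜ[K] M.der m)
      (fun a b => by simp only [map_add, TensorProduct.tmul_add]; abel))
      (fun a b => by
        ext m
        simp only [map_add, TensorProduct.add_tmul, AddMonoidHom.mk'_apply, AddMonoidHom.add_apply]
        abel))
    (fun x n m => by
      simp only [AddMonoidHom.mk'_apply, leibniz, TensorProduct.add_tmul, TensorProduct.tmul_add,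
        TensorProduct.smul_tmul]
      abel)

theorem tensorDer_tmul (N M : DiffMod K) (n : N) (m : M) :
    tensorDer N M (n ⊗ₜ m) = N.der n ⊗ₜ m + n ⊗ₜ M.der m := rfl

/-- The tensor product over `K` of two differential modules. -/
abbrev tensor (N M : DiffMod K) : DiffMod K where
  carrier := N ⊗[K] M
  der := tensorDer N M
  leibniz x w := by
    induction w with
    | zero => simp
    | add a b ha hb => simp only [smul_add, map_add, ha, hb]; abel
    | tmul n m =>
      rw [TensorProduct.smul_tmul', tensorDer_tmul, tensorDer_tmul, leibniz, TensorProduct.add_tmul,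
        smul_add, TensorProduct.smul_tmul', TensorProduct.smul_tmul', TensorProduct.smul_tmul']
      abel

theorem der_act (M : DiffMod K) (m : M) (u : DiffOp K) :
    M.der (M.act m u) = M.act m (u * DiffOp.Y K) := by
  have : M.der.comp (M.act m).toAddMonoidHom = (M.act m).toAddMonoidHom.comp (DiffOp.rightY K) :=
    DiffOp.addHom_ext fun n c => by
      change M.der (M.act m (DiffOp.mono n c)) = M.act m (DiffOp.rightY K (DiffOp.mono n c))
      have h : ∀ (i : ℕ) (x : K), M.act m (DiffOp.mono i x) = x • M.der^[i] m := fun i x => by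
        rw [DiffOp.mono_eq, ← DiffOp.smul_eq_mul_incl, map_smul, act_Y_pow]
      rw [DiffOp.rightY_mono, map_add, h, h, h, leibniz, Function.iterate_succ_apply']
  rw [DiffOp.mul_Y]
  exact DFunLike.congr_fun this u

/-- `◁` is a right action of the ring `U`. -/
theorem act_mul (M : DiffMod K) (m : M) (u v : DiffOp K) :
    M.act m (u * v) = M.act (M.act m u) v := by
  have : M.act m ∘ₗ DiffOp.lmul u = M.act (M.act m u) := DiffOp.hom_ext fun n => by
    change M.act m (u * DiffOp.Y K ^ n) = _
    induction n with
    | zero => rw [act_Y_pow, pow_zero, mul_one]; rfl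
    | succ n ih =>
      rw [pow_succ, ← mul_assoc, ← der_act, ih, act_Y_pow, ← der_act, act_Y_pow]
  exact LinearMap.congr_fun this v

/-- The differential on `U ⧸ P U` given by `u + P U ↦ u Y + P U`. -/
def cyclicDer (P : DiffOp K) :
    (DiffOp K ⧸ LinearMap.range P.lmul) →+ (DiffOp K ⧸ LinearMap.range P.lmul) :=
  QuotientAddGroup.map (LinearMap.range P.lmul).toAddSubgroup
    (LinearMap.range P.lmul).toAddSubgroup (AddMonoidHom.mulRight (DiffOp.Y K)) (by
      rintro _ ⟨v, rfl⟩
      exact ⟨v * DiffOp.Y K, (mul_assoc _ _ _).symm⟩)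

theorem cyclicDer_mk (P u : DiffOp K) :
    cyclicDer P (Submodule.Quotient.mk u) = Submodule.Quotient.mk (u * DiffOp.Y K) := rfl

/-- The differential module `U ⧸ P U` (provided that it is finite-dimensional), where `P U` is the
right ideal generated by `P` and the differential is the right action of `Y`. -/
abbrev cyclic (P : DiffOp K) (hP : Module.Finite K (DiffOp K ⧸ LinearMap.range P.lmul)) :
    DiffMod K where
  carrier := DiffOp K ⧸ LinearMap.range P.lmul
  der := cyclicDer P
  leibniz x m := by
    obtain ⟨u, rfl⟩ := Submodule.Quotient.mk_surjective _ m
    rw [cyclicDer_mk, ← Submodule.Quotient.mk_smul, ← Submodule.Quotient.mk_smul,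
      ← Submodule.Quotient.mk_smul, cyclicDer_mk, ← Submodule.Quotient.mk_add, DiffOp.mul_Y,
      DiffOp.mul_Y, DiffOp.rightY_smul]

end DiffMod

/-! ## The dual `U*` -/

/-- The algebra `U*` of right `K`-linear maps `U → K`, with the convolution product
`(f * g)(u) = ∑ f(u₁) g(u₂)` (Mathlib's convolution algebra of the coalgebra `U`) and the
`K`-algebra structure `x ↦ x ε`. -/
abbrev UDual (K : Type u) [Field K] [Differential K] : Type u := WithConv (DiffOp K →ₗ[K] K)

namespace UDual

theorem ext_Y_pow {f g : UDual K} (h : ∀ n, f (DiffOp.Y K ^ n) = g (DiffOp.Y K ^ n)) : f = g :=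
  WithConv.ofConv_injective (DiffOp.hom_ext h)

theorem mul_Y_pow (f g : UDual K) (n : ℕ) : (f * g) (DiffOp.Y K ^ n) =
    ∑ p ∈ antidiagonal n,
      (n.choose p.1 : K) * (f (DiffOp.Y K ^ p.1) * g (DiffOp.Y K ^ p.2)) := by
  rw [LinearMap.convMul_apply, DiffOp.comul_Y_pow, map_sum, map_sum]
  refine Finset.sum_congr rfl fun p _ => ?_
  rw [map_nsmul, map_nsmul, TensorProduct.map_tmul, LinearMap.mul'_apply, nsmul_eq_mul]

/-- The map `Φ : U* → Hurwitz K`, `f ↦ (f(Yⁿ))ₙ`. -/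
def toHurwitz (f : UDual K) : Hurwitz K := ⟨fun n => f (DiffOp.Y K ^ n)⟩

theorem toHurwitz_injective : Function.Injective (toHurwitz (K := K)) := fun _ _ h =>
  ext_Y_pow fun n => congrFun (congrArg Hurwitz.coeff h) n

theorem unit_act_Y_pow (x : K) (n : ℕ) :
    (DiffMod.unit K).act x (DiffOp.Y K ^ n) = (Hurwitz.target K x).coeff n :=
  DiffMod.act_Y_pow _ _ n

/-- The ring map `μ : K → U*`, `μ(x)(u) = x ◁ u`, coming from the right `U`-module `K`. -/
def mu (K : Type u) [Field K] [Differential K] : K →+* UDual K where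
  toFun x := WithConv.toConv ((DiffMod.unit K).act x)
  map_one' := ext_Y_pow fun n => by
    change (DiffMod.unit K).act (1 : K) (DiffOp.Y K ^ n) = DiffOp.counitMap K (DiffOp.Y K ^ n)
    rw [unit_act_Y_pow, map_one, DiffOp.counitMap_Y_pow, Hurwitz.one_coeff]
  map_zero' := ext_Y_pow fun n => by
    change (DiffMod.unit K).act (0 : K) (DiffOp.Y K ^ n) = 0
    rw [unit_act_Y_pow, map_zero, Hurwitz.zero_coeff]
  map_add' x y := ext_Y_pow fun n => by
    change (DiffMod.unit K).act (x + y : K) (DiffOp.Y K ^ n) =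
      (DiffMod.unit K).act x (DiffOp.Y K ^ n) + (DiffMod.unit K).act y (DiffOp.Y K ^ n)
    rw [unit_act_Y_pow, map_add, Hurwitz.add_coeff, unit_act_Y_pow, unit_act_Y_pow]
  map_mul' x y := ext_Y_pow fun n => by
    change (DiffMod.unit K).act (x * y : K) (DiffOp.Y K ^ n) = _
    rw [unit_act_Y_pow, map_mul, Hurwitz.mul_coeff, mul_Y_pow]
    refine Finset.sum_congr rfl fun p _ => ?_
    change _ = (n.choose p.1 : K) * ((DiffMod.unit K).act x (DiffOp.Y K ^ p.1) *
      (DiffMod.unit K).act y (DiffOp.Y K ^ p.2))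
    rw [unit_act_Y_pow, unit_act_Y_pow]

theorem mu_const (c : constants K) : mu K c = algebraMap K (UDual K) c := ext_Y_pow fun n => by
  rw [LinearMap.convAlgebraMap_apply]
  change (DiffMod.unit K).act (c : K) (DiffOp.Y K ^ n) =
    (c : K) * DiffOp.counitMap K (DiffOp.Y K ^ n)
  rw [unit_act_Y_pow, Hurwitz.target_const, DiffOp.counitMap_Y_pow, Hurwitz.algebraMap_eq,
    Hurwitz.source_coeff, mul_ite, mul_one, mul_zero]

/-- The `(K ⊗ K)`-algebra structure `x ⊗ y ↦ (x ε) * μ(y)` of `U*`. -/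
instance : Algebra (K ⊗[constants K] K) (UDual K) :=
  (twoSided (mu K) mu_const).toAlgebra

instance : IsScalarTower K (K ⊗[constants K] K) (UDual K) where
  smul_assoc x z a := by
    rw [Algebra.smul_def (x • z) a, Algebra.smul_def x (z • a), Algebra.smul_def z a, ← mul_assoc]
    exact congrArg (· * a) (twoSided_smul (mu K) mu_const x z)

end UDual

/-! ## The finite dual `U°` -/

/-- The summand `M* ⊗ M` of the direct sum below. The tensor product is over the constants only:
the relations below with `N = M` impose the balancing over `T_M = End(M, ∂)` (which contains the
constants), so that the final quotient is the same as for `M* ⊗_{T_M} M`. -/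
def CircSummand (M : DiffMod K) : Type u := Module.Dual K M ⊗[constants K] M

instance (M : DiffMod K) : AddCommGroup (CircSummand M) :=
  inferInstanceAs (AddCommGroup (Module.Dual K M ⊗[constants K] M))

instance : DecidableEq (DiffMod K) := Classical.decEq _

/-- The direct sum `⨁_{(M, ∂)} M* ⊗ M` over all differential modules. -/
abbrev CircPre (K : Type u) [Field K] [Differential K] : Type (u + 1) :=
  ⨁ M : DiffMod K, CircSummand M

/-- The inclusion of the summand of `M`. -/
def CircPre.of (M : DiffMod K) : (Module.Dual K M ⊗[constants K] M) →+ CircPre K :=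
  DirectSum.of CircSummand M

/-- The relations `ψ ⊗ f m = (ψ ∘ f) ⊗ m`, for all differential maps `f : M → N`. -/
def circRel (K : Type u) [Field K] [Differential K] : AddSubgroup (CircPre K) :=
  AddSubgroup.closure
    {z | ∃ (M N : DiffMod K) (f : M →ₗ[K] N) (_ : DiffMod.IsHom M N f) (ψ : Module.Dual K N) (m : M),
      z = CircPre.of N (ψ ⊗ₜ f m) - CircPre.of M ((ψ ∘ₗ f) ⊗ₜ m)}

/-- The finite dual `U°`. -/
def Circ (K : Type u) [Field K] [Differential K] : Type (u + 1) := CircPre K ⧸ circRel K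

namespace Circ

instance : AddCommGroup (Circ K) := inferInstanceAs (AddCommGroup (CircPre K ⧸ circRel K))

/-- The quotient map. -/
def proj (K : Type u) [Field K] [Differential K] : CircPre K →+ Circ K :=
  QuotientAddGroup.mk' (circRel K)

/-- The class of `φ ⊗ m`. -/
def mk (M : DiffMod K) (φ : Module.Dual K M) (m : M) : Circ K :=
  proj K (CircPre.of M (φ ⊗ₜ m))

theorem mk_add_left (M : DiffMod K) (φ ψ : Module.Dual K M) (m : M) :
    mk M (φ + ψ) m = mk M φ m + mk M ψ m := by
  simp only [mk, TensorProduct.add_tmul, map_add]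

theorem mk_add_right (M : DiffMod K) (φ : Module.Dual K M) (m n : M) :
    mk M φ (m + n) = mk M φ m + mk M φ n := by
  simp only [mk, TensorProduct.tmul_add, map_add]

theorem mk_hom {M N : DiffMod K} (f : M →ₗ[K] N) (hf : DiffMod.IsHom M N f) (ψ : Module.Dual K N)
    (m : M) : mk N ψ (f m) = mk M (ψ ∘ₗ f) m := by
  rw [mk, mk, ← sub_eq_zero, ← map_sub]
  exact (QuotientAddGroup.eq_zero_iff _).2
    (AddSubgroup.subset_closure ⟨M, N, f, hf, ψ, m, rfl⟩)

theorem ind {p : Circ K → Prop} (h0 : p 0) (hadd : ∀ a b, p a → p b → p (a + b))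
    (hmk : ∀ M φ m, p (mk M φ m)) (a : Circ K) : p a := by
  obtain ⟨z, rfl⟩ := QuotientAddGroup.mk'_surjective (circRel K) a
  change p (proj K z)
  induction z using DirectSum.induction_on with
  | zero => rw [map_zero]; exact h0
  | add x y hx hy => rw [map_add]; exact hadd _ _ hx hy
  | of M w =>
    change p (proj K (CircPre.of M w))
    induction w using TensorProduct.induction_on with
    | zero => rw [map_zero, map_zero]; exact h0
    | add x y hx hy => rw [map_add, map_add]; exact hadd _ _ hx hy
    | tmul φ m => exact hmk M φ m

theorem addHom_ext {A : Type*} [AddCommGroup A] {f g : Circ K →+ A}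
    (h : ∀ M φ m, f (mk M φ m) = g (mk M φ m)) : f = g :=
  DFunLike.ext _ _ fun a => ind (p := fun a => f a = g a) (by rw [map_zero, map_zero])
    (fun a b ha hb => by rw [map_add, map_add, ha, hb]) h a

theorem isHom_const (M : DiffMod K) (c : constants K) :
    DiffMod.IsHom M M ((c : K) • LinearMap.id) := fun m => by
  simp [M.leibniz, deriv_const]

section lift

variable {A : Type*} [AddCommGroup A] (B : ∀ M : DiffMod K, Module.Dual K M →+ M →+ A)
  (hB : ∀ (M N : DiffMod K) (f : M →ₗ[K] N), DiffMod.IsHom M N f →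
    ∀ (ψ : Module.Dual K N) (m : M), B N ψ (f m) = B M (ψ ∘ₗ f) m)

theorem lift_balanced {A : Type*} [AddCommGroup A]
    (B : ∀ M : DiffMod K, Module.Dual K M →+ M →+ A)
    (hB : ∀ (M N : DiffMod K) (f : M →ₗ[K] N), DiffMod.IsHom M N f →
      ∀ (ψ : Module.Dual K N) (m : M), B N ψ (f m) = B M (ψ ∘ₗ f) m) (M : DiffMod K) (c : constants K) (φ : Module.Dual K M) (m : M) :
    B M (c • φ) m = B M φ (c • m) := by
  have h : c • φ = φ ∘ₗ ((c : K) • LinearMap.id) := by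
    ext n
    simp [Subfield.smul_def]
  rw [h, ← hB M M _ (isHom_const M c) φ m]
  rfl

/-- The map defined by `B M` on a summand. -/
def liftSummand (M : DiffMod K) : CircSummand M →+ A :=
  TensorProduct.liftAddHom (B M) (lift_balanced B hB M)

/-- The map defined by `B` on the direct sum. -/
def liftPre : CircPre K →+ A := DirectSum.toAddMonoid (liftSummand B hB)

theorem liftPre_of (M : DiffMod K) (φ : Module.Dual K M) (m : M) :
    liftPre B hB (CircPre.of M (φ ⊗ₜ m)) = B M φ m :=
  DirectSum.toAddMonoid_of (liftSummand B hB) M _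

/-- The universal property of `U°`: biadditive maps `B M : M* × M → A` that are compatible with
all differential maps define an additive map `U° → A`. -/
def lift : Circ K →+ A :=
  QuotientAddGroup.lift (circRel K) (liftPre B hB) ((AddSubgroup.closure_le _).2 (by
    rintro _ ⟨M, N, f, hf, ψ, m, rfl⟩
    rw [SetLike.mem_coe, AddMonoidHom.mem_ker, map_sub, liftPre_of, liftPre_of, sub_eq_zero]
    exact hB M N f hf ψ m))

theorem lift_mk (M : DiffMod K) (φ : Module.Dual K M) (m : M) : lift B hB (mk M φ m) = B M φ m :=
  liftPre_of B hB M φ m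

end lift

/-- A map `M* × M → A` that is additive in both arguments, as a homomorphism. -/
def biadd {A : Type*} [AddCommGroup A] (M : DiffMod K) (F : Module.Dual K M → M → A)
    (h₁ : ∀ φ ψ m, F (φ + ψ) m = F φ m + F ψ m) (h₂ : ∀ φ m n, F φ (m + n) = F φ m + F φ n) :
    Module.Dual K M →+ M →+ A :=
  AddMonoidHom.mk' (fun φ => AddMonoidHom.mk' (F φ) (h₂ φ)) fun φ ψ => by
    ext m; exact h₁ φ ψ m

/-! ### Multiplication -/

/-- `ψ ⋄ φ : q ⊗ p ↦ φ(ψ(q) p) = ψ(q) φ(p)`. -/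
def diamond {N M : DiffMod K} (ψ : Module.Dual K N) (φ : Module.Dual K M) :
    Module.Dual K (DiffMod.tensor N M) :=
  LinearMap.mul' K K ∘ₗ TensorProduct.map ψ φ

theorem diamond_tmul {N M : DiffMod K} (ψ : Module.Dual K N) (φ : Module.Dual K M) (q : N) (p : M) :
    diamond ψ φ (q ⊗ₜ p) = ψ q * φ p := rfl

/-- A linear map out of a tensor product is differential if it is so on pure tensors. -/
theorem isHom_tensor {N M L : DiffMod K} (f : DiffMod.tensor N M →ₗ[K] L)
    (h : ∀ (n : N) (m : M), f (N.der n ⊗ₜ m + n ⊗ₜ M.der m) = L.der (f (n ⊗ₜ m))) :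
    DiffMod.IsHom (DiffMod.tensor N M) L f := fun w => by
  induction w using TensorProduct.induction_on with
  | zero => simp
  | add a b ha hb => rw [map_add, map_add, map_add, map_add, ha, hb]
  | tmul n m => exact h n m

/-- Left multiplication by the class of `φ ⊗ p`. -/
def mulLeft (M : DiffMod K) (φ : Module.Dual K M) (p : M) : Circ K →+ Circ K :=
  lift (fun N => biadd N (fun ψ q => mk (DiffMod.tensor N M) (diamond ψ φ) (q ⊗ₜ p))
      (fun ψ ψ' q => by
        rw [← mk_add_left]
        congr 1
        simp only [diamond, TensorProduct.map_add_left, LinearMap.comp_add])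
      (fun ψ q q' => by rw [TensorProduct.add_tmul, mk_add_right]))
    (fun N N' f hf ψ q => by
      have := mk_hom (M := DiffMod.tensor N M) (N := DiffMod.tensor N' M) (f.rTensor M)
        (isHom_tensor _ fun n m => by
          rw [map_add, LinearMap.rTensor_tmul, LinearMap.rTensor_tmul, LinearMap.rTensor_tmul, hf]
          rfl)
        (diamond ψ φ) (q ⊗ₜ p)
      refine this.trans ?_
      change mk _ _ _ = mk _ _ _
      congr 1
      refine TensorProduct.ext' fun n m => rfl)

theorem mulLeft_mk (M N : DiffMod K) (φ : Module.Dual K M) (p : M) (ψ : Module.Dual K N) (q : N) :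
    mulLeft M φ p (mk N ψ q) = mk (DiffMod.tensor N M) (diamond ψ φ) (q ⊗ₜ p) :=
  lift_mk _ _ N ψ q

/-- The multiplication of `U°`. -/
def mulHom (K : Type u) [Field K] [Differential K] : Circ K →+ Circ K →+ Circ K :=
  lift (fun M => biadd M (mulLeft M)
      (fun φ φ' p => addHom_ext fun N ψ q => by
        rw [AddMonoidHom.add_apply, mulLeft_mk, mulLeft_mk, mulLeft_mk, ← mk_add_left]
        congr 1
        simp only [diamond, TensorProduct.map_add_right, LinearMap.comp_add])
      (fun φ p p' => addHom_ext fun N ψ q => by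
        rw [AddMonoidHom.add_apply, mulLeft_mk, mulLeft_mk, mulLeft_mk, TensorProduct.tmul_add,
          mk_add_right]))
    (fun M M' f hf φ p => addHom_ext fun N ψ q => by
      change mulLeft M' φ (f p) (mk N ψ q) = mulLeft M (φ ∘ₗ f) p (mk N ψ q)
      rw [mulLeft_mk, mulLeft_mk]
      have := mk_hom (M := DiffMod.tensor N M) (N := DiffMod.tensor N M') (f.lTensor N)
        (isHom_tensor _ fun n m => by
          rw [map_add, LinearMap.lTensor_tmul, LinearMap.lTensor_tmul, LinearMap.lTensor_tmul, hf]
          rfl)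
        (diamond ψ φ) (q ⊗ₜ p)
      refine this.trans ?_
      congr 1
      refine TensorProduct.ext' fun n m => rfl)

instance : Mul (Circ K) := ⟨fun a b => mulHom K a b⟩

theorem mul_def (a b : Circ K) : a * b = mulHom K a b := rfl

/-- `[φ ⊗ p] [ψ ⊗ q] = [(ψ ⋄ φ) ⊗ (q ⊗ p)]`. -/
theorem mk_mul_mk (M N : DiffMod K) (φ : Module.Dual K M) (p : M) (ψ : Module.Dual K N) (q : N) :
    mk M φ p * mk N ψ q = mk (DiffMod.tensor N M) (diamond ψ φ) (q ⊗ₜ p) := by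
  rw [mul_def, mulHom, lift_mk]
  exact mulLeft_mk M N φ p ψ q

/-- The unit is the class of `id ⊗ 1 ∈ K* ⊗ K`. -/
instance : One (Circ K) := ⟨mk (DiffMod.unit K) LinearMap.id (1 : K)⟩

theorem one_def : (1 : Circ K) = mk (DiffMod.unit K) LinearMap.id (1 : K) := rfl

theorem add_mul_aux (a b c : Circ K) : (a + b) * c = a * c + b * c := by
  rw [mul_def, map_add]; rfl

theorem mul_add_aux (a b c : Circ K) : a * (b + c) = a * b + a * c := by
  rw [mul_def, map_add]; rfl

theorem zero_mul_aux (a : Circ K) : 0 * a = 0 := by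
  rw [mul_def, map_zero]; rfl

theorem mul_zero_aux (a : Circ K) : a * 0 = 0 := by
  rw [mul_def, map_zero]

theorem mul_comm_aux (a b : Circ K) : a * b = b * a := by
  induction a using ind with
  | h0 => rw [zero_mul_aux, mul_zero_aux]
  | hadd x y hx hy => rw [add_mul_aux, mul_add_aux, hx, hy]
  | hmk M φ p =>
    induction b using ind with
    | h0 => rw [zero_mul_aux, mul_zero_aux]
    | hadd x y hx hy => rw [add_mul_aux, mul_add_aux, hx, hy]
    | hmk N ψ q =>
      rw [mk_mul_mk, mk_mul_mk]
      have := mk_hom (M := DiffMod.tensor N M) (N := DiffMod.tensor M N)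
        (TensorProduct.comm K N M).toLinearMap
        (isHom_tensor _ fun n m => by
          change TensorProduct.comm K N M _ = DiffMod.tensorDer M N (TensorProduct.comm K N M _)
          rw [map_add, TensorProduct.comm_tmul, TensorProduct.comm_tmul, TensorProduct.comm_tmul,
            DiffMod.tensorDer_tmul, add_comm])
        (diamond φ ψ) (q ⊗ₜ p)
      refine Eq.trans ?_ this.symm
      congr 1
      refine TensorProduct.ext' fun n m => ?_
      change ψ n * φ m = φ m * ψ n
      exact mul_comm _ _

theorem mul_assoc_aux (a b c : Circ K) : a * b * c = a * (b * c) := by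
  induction a using ind with
  | h0 => simp only [zero_mul_aux]
  | hadd x y hx hy => simp only [add_mul_aux, hx, hy]
  | hmk M φ p =>
    induction b using ind with
    | h0 => simp only [zero_mul_aux, mul_zero_aux]
    | hadd x y hx hy => simp only [add_mul_aux, mul_add_aux, hx, hy]
    | hmk N ψ q =>
      induction c using ind with
      | h0 => simp only [mul_zero_aux]
      | hadd x y hx hy => simp only [mul_add_aux, hx, hy]
      | hmk L χ r =>
        rw [mk_mul_mk, mk_mul_mk, mk_mul_mk, mk_mul_mk]
        have := mk_hom (M := DiffMod.tensor (DiffMod.tensor L N) M)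
          (N := DiffMod.tensor L (DiffMod.tensor N M))
          (TensorProduct.assoc K L N M).toLinearMap
          (isHom_tensor _ fun w m => by
            change TensorProduct.assoc K L N M (DiffMod.tensorDer L N w ⊗ₜ m + w ⊗ₜ M.der m) =
              DiffMod.tensorDer L (DiffMod.tensor N M) (TensorProduct.assoc K L N M (w ⊗ₜ m))
            induction w using TensorProduct.induction_on with
            | zero => simp
            | add x y hx hy =>
              simp only [map_add, TensorProduct.add_tmul] at hx hy ⊢
              rw [← hx, ← hy]; abel
            | tmul l n =>
              rw [DiffMod.tensorDer_tmul, TensorProduct.add_tmul, map_add, map_add,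
                TensorProduct.assoc_tmul, TensorProduct.assoc_tmul, TensorProduct.assoc_tmul,
                TensorProduct.assoc_tmul, DiffMod.tensorDer_tmul]
              change _ = _ + l ⊗ₜ[K] DiffMod.tensorDer N M (n ⊗ₜ m)
              rw [DiffMod.tensorDer_tmul, TensorProduct.tmul_add, add_assoc])
          (diamond χ (diamond ψ φ)) ((r ⊗ₜ q) ⊗ₜ p)
        refine Eq.trans this ?_
        congr 1
        refine TensorProduct.ext_threefold fun l n m => ?_
        change χ l * (ψ n * φ m) = χ l * ψ n * φ m
        exact (mul_assoc _ _ _).symm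

/-- For `N ⊗ K → N`, `n ⊗ x ↦ n x`. -/
theorem isHom_rid (N : DiffMod K) : DiffMod.IsHom (DiffMod.tensor N (DiffMod.unit K)) N
    (TensorProduct.rid K N).toLinearMap := isHom_tensor _ fun n m => by
  change TensorProduct.rid K N (N.der n ⊗ₜ (m : K) + n ⊗ₜ ((m : K)′)) =
    N.der (TensorProduct.rid K N (n ⊗ₜ (m : K)))
  rw [map_add, TensorProduct.rid_tmul, TensorProduct.rid_tmul, TensorProduct.rid_tmul, N.leibniz]

/-- Multiplication by a class coming from the unit object. -/
theorem mk_unit_mul (φ : Module.Dual K K) (x : K) (N : DiffMod K) (ψ : Module.Dual K N) (q : N) :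
    mk (DiffMod.unit K) φ x * mk N ψ q = mk N (φ 1 • ψ) (x • q) := by
  rw [mk_mul_mk]
  have := mk_hom _ (isHom_rid N) (φ 1 • ψ) (q ⊗ₜ (x : K))
  refine Eq.trans ?_ this.symm
  congr 1
  refine TensorProduct.ext' fun n m => ?_
  change ψ n * φ (m : K) = φ 1 * ψ ((m : K) • n)
  rw [map_smul, smul_eq_mul]
  have : φ (m : K) = m * φ 1 := by rw [← smul_eq_mul, ← map_smul, smul_eq_mul, mul_one]
  rw [this]; ring

theorem one_mul_aux (a : Circ K) : 1 * a = a := by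
  induction a using ind with
  | h0 => rw [mul_zero_aux]
  | hadd x y hx hy => rw [mul_add_aux, hx, hy]
  | hmk M φ p => rw [one_def, mk_unit_mul, LinearMap.id_apply, one_smul, one_smul]

instance : CommRing (Circ K) :=
  { (inferInstance : AddCommGroup (Circ K)) with
    mul_assoc := mul_assoc_aux
    one_mul := one_mul_aux
    mul_one := fun a => by rw [mul_comm_aux, one_mul_aux]
    mul_comm := mul_comm_aux
    left_distrib := mul_add_aux
    right_distrib := add_mul_aux
    zero_mul := zero_mul_aux
    mul_zero := mul_zero_aux }

/-- The source map `x ↦ [x ⊗ 1]` of `U°` (where `x ∈ K = K*`). -/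
def source (K : Type u) [Field K] [Differential K] : K →+* Circ K where
  toFun x := mk (DiffMod.unit K) (x • LinearMap.id) (1 : K)
  map_one' := by rw [one_smul, one_def]
  map_zero' := by
    have := mk_add_left (DiffMod.unit K) (0 • LinearMap.id) (0 • LinearMap.id) (1 : K)
    simpa using this
  map_add' x y := by rw [add_smul, mk_add_left]
  map_mul' x y := by
    rw [mk_unit_mul, one_smul, smul_smul]
    simp

/-- The target map `x ↦ [1 ⊗ x]` of `U°`. -/
def target (K : Type u) [Field K] [Differential K] : K →+* Circ K where
  toFun x := mk (DiffMod.unit K) LinearMap.id (x : K)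
  map_one' := rfl
  map_zero' := by
    have := mk_add_right (DiffMod.unit K) LinearMap.id (0 : K) (0 : K)
    simpa using this
  map_add' x y := mk_add_right (DiffMod.unit K) LinearMap.id x y
  map_mul' x y := by
    rw [mk_unit_mul]
    simp

theorem target_apply (x : K) : target K x = mk (DiffMod.unit K) LinearMap.id (x : K) := rfl

/-- `U°` is a `K`-algebra through the source map. -/
instance : Algebra K (Circ K) := (source K).toAlgebra

theorem algebraMap_apply (x : K) :
    algebraMap K (Circ K) x = mk (DiffMod.unit K) (x • LinearMap.id) (1 : K) := rfl

theorem smul_mk (x : K) (M : DiffMod K) (φ : Module.Dual K M) (m : M) :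
    x • mk M φ m = mk M (x • φ) m := by
  rw [Algebra.smul_def, algebraMap_apply, mk_unit_mul, one_smul]
  simp

theorem target_const (c : constants K) : target K c = algebraMap K (Circ K) c := by
  rw [target_apply, algebraMap_apply]
  have := mk_hom _ (isHom_const (DiffMod.unit K) c) LinearMap.id (1 : K)
  rw [LinearMap.id_comp] at this
  rw [← this]
  simp

/-- The `(K ⊗ K)`-algebra structure `x ⊗ y ↦ [x ⊗ 1] [1 ⊗ y]` of `U°`. -/
instance : Algebra (K ⊗[constants K] K) (Circ K) :=
  (twoSided (target K) target_const).toAlgebra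

instance : IsScalarTower K (K ⊗[constants K] K) (Circ K) where
  smul_assoc x z a := by
    rw [Algebra.smul_def (x • z) a, Algebra.smul_def x (z • a), Algebra.smul_def z a, ← mul_assoc]
    exact congrArg (· * a) (twoSided_smul (target K) target_const x z)

/-! ### Derivation and canonical map -/

/-- The additive map `[φ ⊗ m] ↦ [φ ⊗ ∂m]`. -/
def derAdd (K : Type u) [Field K] [Differential K] : Circ K →+ Circ K :=
  lift (fun M => biadd M (fun φ m => mk M φ (M.der m))
      (fun φ ψ m => mk_add_left M φ ψ _)
      (fun φ m n => by rw [map_add, mk_add_right]))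
    (fun M N f hf ψ m => by
      change mk N ψ (N.der (f m)) = mk M (ψ ∘ₗ f) (M.der m)
      rw [← hf, mk_hom f hf])

theorem derAdd_mk (M : DiffMod K) (φ : Module.Dual K M) (m : M) :
    derAdd K (mk M φ m) = mk M φ (M.der m) := lift_mk _ _ M φ m

theorem derAdd_mul (a b : Circ K) : derAdd K (a * b) = a * derAdd K b + b * derAdd K a := by
  induction a using ind with
  | h0 => simp only [zero_mul, map_zero, mul_zero, add_zero]
  | hadd x y hx hy => rw [add_mul, map_add, hx, hy, add_mul, map_add, mul_add]; abel
  | hmk M φ p =>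
    induction b using ind with
    | h0 => simp only [zero_mul, map_zero, mul_zero, add_zero]
    | hadd x y hx hy => rw [mul_add, map_add, hx, hy, add_mul, map_add, mul_add]; abel
    | hmk N ψ q =>
      rw [mul_comm (mk N ψ q), derAdd_mk, derAdd_mk, mk_mul_mk, mk_mul_mk, mk_mul_mk, derAdd_mk,
        ← mk_add_right]
      rfl

/-- The derivation `[φ ⊗ m] ↦ [φ ⊗ ∂m]` of the `K`-algebra `U°`. -/
def der (K : Type u) [Field K] [Differential K] : Derivation K (Circ K) (Circ K) :=
  Derivation.mk'
    { toFun := fun a => derAdd K a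
      map_add' := map_add _
      map_smul' := fun x a => by
        rw [RingHom.id_apply]
        induction a using ind with
        | h0 => rw [smul_zero, map_zero, smul_zero]
        | hadd a b ha hb => rw [smul_add, map_add, ha, hb, map_add, smul_add]
        | hmk M φ m => rw [smul_mk, derAdd_mk, derAdd_mk, smul_mk] }
    derAdd_mul

theorem der_mk (M : DiffMod K) (φ : Module.Dual K M) (m : M) :
    der K (mk M φ m) = mk M φ (M.der m) := derAdd_mk M φ m

/-- The canonical map `ζ : U° → U*`, `ζ([φ ⊗ m])(u) = φ(m ◁ u)`. -/
def zeta (K : Type u) [Field K] [Differential K] : Circ K →+ UDual K :=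
  lift (fun M => biadd M (fun φ m => WithConv.toConv (φ ∘ₗ M.act m))
      (fun φ ψ m => rfl)
      (fun φ m n => UDual.ext_Y_pow fun i => by
        change φ (M.act (m + n) (DiffOp.Y K ^ i)) =
          φ (M.act m (DiffOp.Y K ^ i)) + φ (M.act n (DiffOp.Y K ^ i))
        rw [DiffMod.act_Y_pow, DiffMod.act_Y_pow, DiffMod.act_Y_pow, iterate_map_add, map_add]))
    (fun M N f hf ψ m => UDual.ext_Y_pow fun i => by
      change ψ (N.act (f m) (DiffOp.Y K ^ i)) = ψ (f (M.act m (DiffOp.Y K ^ i)))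
      rw [DiffMod.act_Y_pow, DiffMod.act_Y_pow]
      congr 1
      exact (Function.Semiconj.iterate_right (f := f) (fun x => hf x) i m).symm)

theorem zeta_mk (M : DiffMod K) (φ : Module.Dual K M) (m : M) (u : DiffOp K) :
    zeta K (mk M φ m) u = φ (M.act m u) := by
  rw [zeta, lift_mk]
  rfl

end Circ

end

end DRS

/-!
A linear form `f` on `U` is determined by the values `f(Yⁿ)`, and the comultiplication of `U`
turns convolution into the Hurwitz product, so `Φ` is an isomorphism. Under `Φ`, precomposition of
`f` with left multiplication by `Y` becomes the shift, and precomposition with left multiplication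
by `x ∈ K` becomes multiplication by `t(x)` (`UDual.toHurwitz_precomp_incl`). Hence the operator
`∑ t(cᵢ) 𝒩ⁱ` kills `Φ(f)` if and only if `f` vanishes on the right ideal `P U` with
`P = ∑ Yⁱ cᵢ` (`UDual.operator_eq_zero_iff`).

The map `Φ ∘ ζ` sends `[φ ⊗ m]` to `(φ(∂ⁿ m))ₙ`. It intertwines the derivation of `U°` with the
shift; multiplicativity of `ζ` follows by comparing Leibniz rules. Every element of `U°` is a
single class `[φ ⊗ m]` (`Circ.exists_eq_mk`). If `ζ` kills it, then `φ` vanishes on the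
differential submodule `m ◁ U`, from which the class is pulled back, so the class is zero
(`Circ.zeta_injective`).

The image of `Φ ∘ ζ` is `Dlin K` (`Circ.coe_range_toHurwitzAlgHom`). On the one hand `m` is
annihilated by a nonzero differential operator, since `M` is finite-dimensional. On the other hand,
if `f` vanishes on `P U` with `c_d ≠ 0`, then `U ⧸ P U` is spanned by the `Yⁱ` with `i < d`
(`DiffMod.finite_quotient_ofCoeffs`), and `f` is the image under `ζ` of the class of the induced
form and the generator `1` (`Circ.zeta_mk_cyclic`). Thus `Dlin K` is a subalgebra because it is the
range of an algebra homomorphism, and the formula for the inverse comes from the second half of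
this argument.
-/

namespace DRS

noncomputable section

variable {K : Type u} [Field K] [Differential K]

/-! ### Ring homomorphisms compatible with the source and target maps -/

/-- A ring homomorphism compatible with both structure maps `s` and `t` is compatible with the
`(K ⊗ K)`-algebra structures. -/
theorem map_twoSided {A B : Type*} [CommRing A] [Algebra K A] [CommRing B] [Algebra K B]
    {t : K →+* A} (ht : ∀ c : constants K, t c = algebraMap K A c)
    {t' : K →+* B} (ht' : ∀ c : constants K, t' c = algebraMap K B c) (F : A →+* B)
    (hs : ∀ x, F (algebraMap K A x) = algebraMap K B x) (hF : ∀ x, F (t x) = t' x)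
    (z : K ⊗[constants K] K) : F (twoSided t ht z) = twoSided t' ht' z := by
  induction z using TensorProduct.induction_on with
  | zero => simp only [map_zero]
  | add a b ha hb => simp only [map_add, ha, hb]
  | tmul a b => rw [twoSided_tmul, twoSided_tmul, map_mul, hs, hF]

/-! ### The dual of `U` and Hurwitz series -/

namespace UDual

theorem toHurwitz_coeff (f : UDual K) (n : ℕ) : (toHurwitz f).coeff n = f (DiffOp.Y K ^ n) := rfl

theorem toHurwitz_algebraMap (x : K) :
    toHurwitz (algebraMap K (UDual K) x) = algebraMap K (Hurwitz K) x :=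
  Hurwitz.ext_coeff fun n => by
    rw [toHurwitz_coeff, LinearMap.convAlgebraMap_apply, Hurwitz.algebraMap_eq,
      Hurwitz.source_coeff]
    change x * DiffOp.counitMap K (DiffOp.Y K ^ n) = _
    rw [DiffOp.counitMap_Y_pow, mul_ite, mul_one, mul_zero]

theorem toHurwitz_mu (x : K) : toHurwitz (mu K x) = Hurwitz.target K x :=
  Hurwitz.ext_coeff fun n => unit_act_Y_pow x n

/-- The ring isomorphism `U* ≃ Hurwitz K`, `f ↦ (f(Yⁿ))ₙ`. -/
def toHurwitzRingEquiv (K : Type u) [Field K] [Differential K] : UDual K ≃+* Hurwitz K where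
  toFun := toHurwitz
  invFun a := WithConv.toConv ((DiffOp.basis K).constr K a.coeff)
  left_inv f := ext_Y_pow fun n => by
    rw [DiffOp.Y_pow, ← DiffOp.basis_apply]
    refine ((DiffOp.basis K).constr_basis K _ n).trans ?_
    rw [toHurwitz_coeff, DiffOp.Y_pow, DiffOp.basis_apply]
  right_inv a := Hurwitz.ext_coeff fun n => by
    rw [toHurwitz_coeff, DiffOp.Y_pow, ← DiffOp.basis_apply]
    exact (DiffOp.basis K).constr_basis K _ n
  map_mul' f g := Hurwitz.ext_coeff fun n => mul_Y_pow f g n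
  map_add' _ _ := rfl

/-- The isomorphism `Φ` of `(K ⊗ K)`-algebras. -/
def toHurwitzAlgEquiv (K : Type u) [Field K] [Differential K] :
    UDual K ≃ₐ[K ⊗[constants K] K] Hurwitz K :=
  AlgEquiv.ofRingEquiv (f := toHurwitzRingEquiv K)
    (map_twoSided mu_const Hurwitz.target_const (toHurwitzRingEquiv K : UDual K →+* Hurwitz K)
      toHurwitz_algebraMap toHurwitz_mu)

theorem toHurwitzAlgEquiv_apply (f : UDual K) : toHurwitzAlgEquiv K f = toHurwitz f := rfl

/-- The linear form `u ↦ f(P u)`. -/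
def precomp (P : DiffOp K) (f : UDual K) : UDual K := WithConv.toConv (f.ofConv ∘ₗ P.lmul)

theorem precomp_apply (P : DiffOp K) (f : UDual K) (u : DiffOp K) : precomp P f u = f (P * u) :=
  rfl

theorem precomp_mul (P Q : DiffOp K) (f : UDual K) :
    precomp (P * Q) f = precomp Q (precomp P f) :=
  ext_Y_pow fun n => by simp only [precomp_apply, mul_assoc]

theorem toHurwitz_precomp_Y (f : UDual K) :
    toHurwitz (precomp (DiffOp.Y K) f) = Hurwitz.shift K (toHurwitz f) :=
  Hurwitz.ext_coeff fun n => by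
    rw [toHurwitz_coeff, precomp_apply, ← pow_succ', Hurwitz.shift_coeff, toHurwitz_coeff]

theorem toHurwitz_precomp_Y_pow (i : ℕ) (f : UDual K) :
    toHurwitz (precomp (DiffOp.Y K ^ i) f) = (Hurwitz.shift K)^[i] (toHurwitz f) := by
  induction i with
  | zero =>
    exact Hurwitz.ext_coeff fun n => by
      rw [toHurwitz_coeff, precomp_apply, pow_zero, one_mul]; rfl
  | succ i ih =>
    rw [pow_succ, precomp_mul, toHurwitz_precomp_Y, ih, Function.iterate_succ_apply']

/-- Left multiplication by a scalar `x` of `U` becomes multiplication by `t(x)`; this is the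
commutation rule `x Y = Y x + ∂(x)` compared with the Leibniz rule for the shift. -/
theorem toHurwitz_precomp_incl (x : K) (f : UDual K) :
    toHurwitz (precomp (DiffOp.incl K x) f) = Hurwitz.target K x * toHurwitz f :=
  Hurwitz.ext_coeff fun n => by
    induction n generalizing x f with
    | zero =>
      rw [Hurwitz.mul_coeff_zero, toHurwitz_coeff, precomp_apply, pow_zero, mul_one, ← one_mul
        (DiffOp.incl K x), ← DiffOp.smul_eq_mul_incl, toHurwitz_coeff, pow_zero]
      exact map_smul f.ofConv x 1
    | succ n ih =>
      have hx : Hurwitz.shiftAdd (Hurwitz.target K x) = Hurwitz.target K x′ := rfl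
      have hf : Hurwitz.shiftAdd (toHurwitz f) = toHurwitz (precomp (DiffOp.Y K) f) :=
        (toHurwitz_precomp_Y f).symm
      rw [← Hurwitz.shiftAdd_coeff (_ * _), Hurwitz.shiftAdd_mul, hx, hf, Hurwitz.add_coeff,
        ← ih, ← ih]
      simp only [toHurwitz_coeff, precomp_apply]
      rw [pow_succ', ← mul_assoc, DiffOp.incl_mul_Y, add_mul, mul_assoc, add_comm]
      exact map_add f.ofConv _ _

theorem precomp_sum {ι : Type*} (s : Finset ι) (P : ι → DiffOp K) (f : UDual K) (u : DiffOp K) :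
    precomp (∑ i ∈ s, P i) f u = ∑ i ∈ s, precomp (P i) f u := by
  simp only [precomp_apply, Finset.sum_mul]
  exact map_sum f.ofConv _ _

/-- The operator `∑ t(cᵢ) 𝒩ⁱ` is dual to left multiplication by `P = ∑ Yⁱ cᵢ`. -/
theorem toHurwitz_precomp_ofCoeffs (d : ℕ) (c : ℕ → K) (f : UDual K) :
    toHurwitz (precomp (DiffOp.ofCoeffs d c) f) = Hurwitz.operator d c (toHurwitz f) := by
  have hsum : ∀ (s : Finset ℕ) (g : ℕ → Hurwitz K) (n : ℕ),
      (∑ i ∈ s, g i).coeff n = ∑ i ∈ s, (g i).coeff n := fun s g n => by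
    induction s using Finset.cons_induction with
    | empty => rfl
    | cons a s ha ih => rw [Finset.sum_cons, Finset.sum_cons, Hurwitz.add_coeff, ih]
  refine Hurwitz.ext_coeff fun n => ?_
  rw [Hurwitz.operator, hsum, toHurwitz_coeff, DiffOp.ofCoeffs, precomp_sum]
  refine Finset.sum_congr rfl fun i _ => ?_
  rw [← toHurwitz_coeff, precomp_mul, toHurwitz_precomp_incl, toHurwitz_precomp_Y_pow]

/-- A sequence is killed by `∑ t(cᵢ) 𝒩ⁱ` exactly when the corresponding linear form vanishes on
the right ideal `P U`, where `P = ∑ Yⁱ cᵢ`. -/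
theorem operator_eq_zero_iff (d : ℕ) (c : ℕ → K) (f : UDual K) :
    Hurwitz.operator d c (toHurwitz f) = 0 ↔ ∀ u, f (DiffOp.ofCoeffs d c * u) = 0 := by
  rw [← toHurwitz_precomp_ofCoeffs]
  constructor
  · intro h u
    have : precomp (DiffOp.ofCoeffs d c) f = 0 := toHurwitz_injective h
    rw [← precomp_apply, this]
    rfl
  · exact fun h => Hurwitz.ext_coeff fun n => h _

end UDual

/-! ### Cyclic differential modules -/

/-- Modulo `P U`, where `P = ∑_{i ≤ d} Yⁱ cᵢ` with `c_d ≠ 0`, the ring `U` is spanned by the `Yⁱ`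
with `i < d`. -/
theorem DiffMod.finite_quotient_ofCoeffs (d : ℕ) (c : ℕ → K) (hc : c d ≠ 0) :
    Module.Finite K (DiffOp K ⧸ LinearMap.range (DiffOp.ofCoeffs d c).lmul) := by
  let P := DiffOp.ofCoeffs d c
  let q : DiffOp K →ₗ[K] DiffOp K ⧸ LinearMap.range P.lmul := Submodule.mkQ _
  let W : Submodule K (DiffOp K ⧸ LinearMap.range P.lmul) :=
    Submodule.span K ((fun i => q (DiffOp.Y K ^ i)) '' (Finset.range d : Set ℕ))
  have hlt : ∀ i < d, q (DiffOp.Y K ^ i) ∈ W := fun i hi =>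
    Submodule.subset_span ⟨i, by simpa using hi, rfl⟩
  have hqd : q (DiffOp.Y K ^ d) ∈ W := by
    have h0 : q P = 0 := (Submodule.Quotient.mk_eq_zero _).2 ⟨1, mul_one P⟩
    have hsum : q P = ∑ i ∈ Finset.range (d + 1), c i • q (DiffOp.Y K ^ i) := by
      simp only [← map_smul, ← map_sum, DiffOp.smul_eq_mul_incl]
      rfl
    rw [hsum, Finset.sum_range_succ, add_comm] at h0
    rw [← Submodule.smul_mem_iff W hc, eq_neg_of_add_eq_zero_left h0, neg_mem_iff]
    exact Submodule.sum_mem _ fun i hi => W.smul_mem _ (hlt i (Finset.mem_range.1 hi))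
  have hder : ∀ w ∈ W, cyclicDer P w ∈ W := fun w hw => by
    induction hw using Submodule.span_induction with
    | mem w hw =>
      obtain ⟨i, hi, rfl⟩ := hw
      have hi : i < d := by simpa using hi
      have : cyclicDer P (q (DiffOp.Y K ^ i)) = q (DiffOp.Y K ^ (i + 1)) := by
        rw [pow_succ]; rfl
      rw [this]
      rcases Nat.lt_or_ge (i + 1) d with h | h
      · exact hlt _ h
      · rwa [show i + 1 = d by omega]
    | zero => rw [map_zero]; exact W.zero_mem
    | add a b _ _ ha hb => rw [map_add]; exact W.add_mem ha hb
    | smul x w hw ih =>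
      obtain ⟨u, rfl⟩ := Submodule.Quotient.mk_surjective _ w
      have : cyclicDer P (x • Submodule.Quotient.mk u) =
          x • cyclicDer P (Submodule.Quotient.mk u) + x′ • Submodule.Quotient.mk u := by
        rw [cyclicDer_mk, ← Submodule.Quotient.mk_smul, cyclicDer_mk, DiffOp.mul_Y,
          DiffOp.rightY_smul, DiffOp.mul_Y]
        rfl
      rw [this]
      exact W.add_mem (W.smul_mem _ ih) (W.smul_mem _ hw)
  have hpow : ∀ n, q (DiffOp.Y K ^ n) ∈ W := fun n => by
    induction n with
    | zero =>
      rcases Nat.eq_zero_or_pos d with h | h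
      · rwa [h] at hqd
      · exact hlt 0 h
    | succ n ih =>
      rw [pow_succ]
      exact hder _ ih
  have htop : W = ⊤ := by
    have hq : Submodule.map q ⊤ = ⊤ := (Submodule.map_top q).trans (Submodule.range_mkQ _)
    rw [eq_top_iff, ← hq, ← (DiffOp.basis K).span_eq, Submodule.map_span, Submodule.span_le]
    rintro _ ⟨_, ⟨n, rfl⟩, rfl⟩
    rw [DiffOp.basis_apply, ← DiffOp.Y_pow]
    exact hpow n
  exact ⟨htop ▸ Submodule.fg_span (((Finset.range d).finite_toSet).image _)⟩

theorem DiffMod.act_cyclic (P : DiffOp K)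
    (hP : Module.Finite K (DiffOp K ⧸ LinearMap.range P.lmul)) (u : DiffOp K) :
    (DiffMod.cyclic P hP).act (Submodule.Quotient.mk 1) u = Submodule.Quotient.mk u := by
  have : (DiffMod.cyclic P hP).act (Submodule.Quotient.mk 1) = Submodule.mkQ _ :=
    DiffOp.hom_ext fun n => by
      induction n with
      | zero => rw [DiffMod.act_Y_pow, pow_zero]; rfl
      | succ n ih =>
        rw [pow_succ, ← DiffMod.der_act, ih]
        rfl
  exact LinearMap.congr_fun this u

/-! ### Differential submodules and products -/

namespace DiffMod

/-- The differential submodule `m ◁ U` of `M` generated by `m`. -/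
abbrev orbit (M : DiffMod K) (m : M) : DiffMod K where
  carrier := LinearMap.range (M.act m)
  der :=
    { toFun := fun w => ⟨M.der w, by
        obtain ⟨_, u, rfl⟩ := w
        exact ⟨u * DiffOp.Y K, (M.der_act m u).symm⟩⟩
      map_zero' := Subtype.ext (map_zero M.der)
      map_add' := fun a b => Subtype.ext (map_add M.der _ _) }
  leibniz x w := Subtype.ext (M.leibniz x w)

/-- The product of two differential modules. -/
abbrev prod (M N : DiffMod K) : DiffMod K where
  carrier := M × N
  der := M.der.prodMap N.der
  leibniz x w := Prod.ext (M.leibniz x w.1) (N.leibniz x w.2)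

/-- Every vector `m` of a differential module is annihilated by some `∑_{i ≤ d} Yⁱ cᵢ` with
`c_d ≠ 0`, because the `∂ⁱ m` are linearly dependent. -/
theorem exists_act_ofCoeffs_eq_zero (M : DiffMod K) (m : M) :
    ∃ (d : ℕ) (c : ℕ → K), c d ≠ 0 ∧ M.act m (DiffOp.ofCoeffs d c) = 0 := by
  have hdep : ¬ Function.Injective (M.act m) := fun hinj => by
    have : Module.Finite K (DiffOp K) := Module.Finite.of_injective _ hinj
    have := Module.Finite.finite_basis (DiffOp.basis K)
    exact not_finite ℕ
  obtain ⟨P, hP, hP0⟩ : ∃ P : DiffOp K, M.act m P = 0 ∧ P ≠ 0 := by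
    by_contra! h
    exact hdep ((injective_iff_map_eq_zero _).2 h)
  let c : ℕ →₀ K := P
  have hc : c.support.Nonempty := Finsupp.support_nonempty_iff.2 hP0
  refine ⟨c.support.max' hc, c, Finsupp.mem_support_iff.1 (Finset.max'_mem _ hc), ?_⟩
  rw [← hP]
  congr 1
  refine Eq.trans ?_ (Finsupp.sum_single c)
  rw [DiffOp.ofCoeffs, Finsupp.sum_of_support_subset c
    (s := Finset.range (c.support.max' hc + 1))
    (fun i hi => Finset.mem_range.2 (Nat.lt_succ_of_le (Finset.le_max' _ i hi))) _
    (fun i _ => Finsupp.single_zero i)]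
  exact Finset.sum_congr rfl fun i _ => (DiffOp.mono_eq i (c i)).symm

end DiffMod

/-! ### The canonical map from the finite dual -/

namespace Circ

/-- Every element of `U°` is the class of a single pure tensor: a sum of two classes lives on the
product of the two differential modules. -/
theorem exists_eq_mk (a : Circ K) :
    ∃ (M : DiffMod K) (φ : Module.Dual K M) (m : M), a = mk M φ m := by
  induction a using ind with
  | h0 =>
    refine ⟨DiffMod.unit K, LinearMap.id, (0 : K), ?_⟩
    rw [← target_apply, map_zero]
  | hadd a b ha hb =>
    obtain ⟨M, φ, m, rfl⟩ := ha
    obtain ⟨N, ψ, n, rfl⟩ := hb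
    refine ⟨DiffMod.prod M N, φ ∘ₗ LinearMap.fst K M N + ψ ∘ₗ LinearMap.snd K M N, (m, n), ?_⟩
    have h₁ := mk_hom (M := DiffMod.prod M N) (LinearMap.fst K M N) (fun _ => rfl) φ (m, n)
    have h₂ := mk_hom (M := DiffMod.prod M N) (LinearMap.snd K M N) (fun _ => rfl) ψ (m, n)
    rw [mk_add_left, ← h₁, ← h₂]
    rfl
  | hmk M φ m => exact ⟨M, φ, m, rfl⟩

/-- If `φ` vanishes on `m ◁ U`, then `[φ ⊗ m]` comes from the zero form on the submodule
`m ◁ U`. -/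
theorem zeta_injective : Function.Injective (zeta K) :=
  (injective_iff_map_eq_zero _).2 fun a ha => by
    obtain ⟨M, φ, m, rfl⟩ := exists_eq_mk a
    have hm : M.act m 1 = m := by
      have := M.act_Y_pow m 0
      rwa [pow_zero] at this
    have h := mk_hom (M := DiffMod.orbit M m) (LinearMap.range (M.act m)).subtype (fun _ => rfl) φ
      ⟨m, 1, hm⟩
    have h0 : φ ∘ₗ (LinearMap.range (M.act m)).subtype = 0 := LinearMap.ext fun w => by
      obtain ⟨_, u, rfl⟩ := w
      change φ (M.act m u) = 0
      rw [← zeta_mk, ha]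
      rfl
    refine h.trans ?_
    rw [h0]
    have := mk_add_left (DiffMod.orbit M m) 0 0 ⟨m, 1, hm⟩
    rwa [add_zero, left_eq_add] at this

/-- The sequence of `[φ ⊗ m]` is `(φ(∂ⁿ m))ₙ`. -/
theorem toHurwitz_zeta_mk_coeff (M : DiffMod K) (φ : Module.Dual K M) (m : M) (n : ℕ) :
    (UDual.toHurwitz (zeta K (mk M φ m))).coeff n = φ (M.der^[n] m) := by
  rw [UDual.toHurwitz_coeff, zeta_mk, DiffMod.act_Y_pow]

theorem toHurwitz_zeta_der (a : Circ K) :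
    UDual.toHurwitz (zeta K (der K a)) = Hurwitz.shift K (UDual.toHurwitz (zeta K a)) := by
  obtain ⟨M, φ, m, rfl⟩ := exists_eq_mk a
  refine Hurwitz.ext_coeff fun n => ?_
  rw [der_mk, toHurwitz_zeta_mk_coeff, Hurwitz.shift_coeff, toHurwitz_zeta_mk_coeff,
    Function.iterate_succ_apply]

theorem zeta_mul (a b : Circ K) : zeta K (a * b) = zeta K a * zeta K b := by
  refine UDual.toHurwitz_injective ?_
  refine Eq.trans ?_ (map_mul (UDual.toHurwitzAlgEquiv K) (zeta K a) (zeta K b)).symm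
  simp only [UDual.toHurwitzAlgEquiv_apply]
  refine Hurwitz.ext_coeff fun n => ?_
  -- both sides satisfy the Leibniz rule for the shift and have the same term at `0`
  induction n generalizing a b with
  | zero =>
    obtain ⟨M, φ, m, rfl⟩ := exists_eq_mk a
    obtain ⟨N, ψ, n, rfl⟩ := exists_eq_mk b
    rw [Hurwitz.mul_coeff_zero, mk_mul_mk, toHurwitz_zeta_mk_coeff, toHurwitz_zeta_mk_coeff,
      toHurwitz_zeta_mk_coeff]
    exact mul_comm (ψ n) (φ m)
  | succ n ih =>
    rw [← Hurwitz.shift_coeff, ← toHurwitz_zeta_der, ← Hurwitz.shift_coeff (_ * _),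
      Derivation.leibniz, Derivation.leibniz, ← toHurwitz_zeta_der, ← toHurwitz_zeta_der,
      map_add, smul_eq_mul, smul_eq_mul, smul_eq_mul, smul_eq_mul, Hurwitz.add_coeff, ← ih, ← ih]
    rfl

theorem zeta_target (x : K) : zeta K (target K x) = UDual.mu K x :=
  UDual.ext_Y_pow fun _ => zeta_mk _ _ _ _

theorem zeta_algebraMap (x : K) : zeta K (algebraMap K (Circ K) x) = algebraMap K (UDual K) x := by
  refine UDual.toHurwitz_injective ?_
  rw [UDual.toHurwitz_algebraMap]
  refine Hurwitz.ext_coeff fun n => ?_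
  rw [algebraMap_apply, toHurwitz_zeta_mk_coeff]
  change x * (Hurwitz.target K (1 : K)).coeff n = _
  rw [map_one, Hurwitz.algebraMap_eq, Hurwitz.source_coeff, Hurwitz.one_coeff, mul_ite, mul_one,
    mul_zero]

/-- The map `ζ` as a ring homomorphism. -/
def zetaRingHom (K : Type u) [Field K] [Differential K] : Circ K →+* UDual K :=
  { zeta K with
    map_one' := by
      change zeta K 1 = 1
      rw [← map_one (target K), zeta_target, map_one]
    map_mul' := zeta_mul }

/-- The map `ζ` as a homomorphism of `(K ⊗ K)`-algebras. -/
def zetaAlgHom (K : Type u) [Field K] [Differential K] :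
    Circ K →ₐ[K ⊗[constants K] K] UDual K where
  __ := zetaRingHom K
  commutes' := map_twoSided target_const UDual.mu_const (zetaRingHom K) zeta_algebraMap zeta_target

theorem toHurwitz_zeta_mem_Dlin (a : Circ K) : UDual.toHurwitz (zeta K a) ∈ Dlin K := by
  obtain ⟨M, φ, m, rfl⟩ := exists_eq_mk a
  obtain ⟨d, c, hc, h⟩ := M.exists_act_ofCoeffs_eq_zero m
  refine ⟨d, c, hc, (UDual.operator_eq_zero_iff d c _).2 fun u => ?_⟩
  have h0 : M.act 0 u = 0 := by
    have : M.act 0 = 0 := DiffOp.hom_ext fun n => by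
      rw [DiffMod.act_Y_pow, iterate_map_zero]; rfl
    rw [this]; rfl
  rw [zeta_mk, DiffMod.act_mul, h, h0, map_zero]

/-- A linear form `f` on `U` that vanishes on `P U`, as a linear form on `U ⧸ P U`. -/
def descend (P : DiffOp K) (f : UDual K) (hf : ∀ u, f (P * u) = 0) :
    Module.Dual K (DiffOp K ⧸ LinearMap.range P.lmul) :=
  Submodule.liftQ _ f.ofConv (by
    rintro _ ⟨u, rfl⟩
    exact hf u)

theorem zeta_mk_cyclic (P : DiffOp K)
    (hP : Module.Finite K (DiffOp K ⧸ LinearMap.range P.lmul)) (f : UDual K)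
    (hf : ∀ u, f (P * u) = 0) :
    zeta K (mk (DiffMod.cyclic P hP) (descend P f hf) (Submodule.Quotient.mk 1)) = f :=
  UDual.ext_Y_pow fun n => by
    rw [zeta_mk, DiffMod.act_cyclic]
    rfl

/-- The homomorphism `Φ ∘ ζ` of `(K ⊗ K)`-algebras. -/
def toHurwitzAlgHom (K : Type u) [Field K] [Differential K] :
    Circ K →ₐ[K ⊗[constants K] K] Hurwitz K :=
  (UDual.toHurwitzAlgEquiv K : UDual K →ₐ[K ⊗[constants K] K] Hurwitz K).comp (zetaAlgHom K)

theorem toHurwitzAlgHom_injective : Function.Injective (toHurwitzAlgHom K) :=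
  UDual.toHurwitz_injective.comp zeta_injective

theorem coe_range_toHurwitzAlgHom : ((toHurwitzAlgHom K).range : Set (Hurwitz K)) = Dlin K := by
  ext α
  constructor
  · rintro ⟨a, rfl⟩
    exact toHurwitz_zeta_mem_Dlin a
  · rintro ⟨d, c, hc, h⟩
    obtain ⟨f, rfl⟩ := (UDual.toHurwitzAlgEquiv K).surjective α
    have hf := (UDual.operator_eq_zero_iff d c f).1 h
    have hP := DiffMod.finite_quotient_ofCoeffs d c hc
    exact ⟨mk (DiffMod.cyclic _ hP) (descend _ f hf) (Submodule.Quotient.mk 1),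
      congrArg UDual.toHurwitz (zeta_mk_cyclic _ hP f hf)⟩

/-- The restriction of the shift to the image of `U°`, as a linear map. -/
def shiftRangeLinear (K : Type u) [Field K] [Differential K] :
    (toHurwitzAlgHom K).range →ₗ[K] (toHurwitzAlgHom K).range where
  toFun α := ⟨Hurwitz.shift K (α : Hurwitz K), by
    obtain ⟨a, ha⟩ := α.2
    exact ⟨der K a, (toHurwitz_zeta_der a).trans (congrArg (Hurwitz.shift K) ha)⟩⟩
  map_add' α β := Subtype.ext (map_add (Hurwitz.shift K) (α : Hurwitz K) β)
  map_smul' x α := Subtype.ext ((Hurwitz.shift K).map_smul x (α : Hurwitz K))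

/-- The restriction of the shift to the image of `U°`, as a derivation. -/
def shiftRange (K : Type u) [Field K] [Differential K] :
    Derivation K (toHurwitzAlgHom K).range (toHurwitzAlgHom K).range where
  toLinearMap := shiftRangeLinear K
  map_one_eq_zero' := Subtype.ext (Hurwitz.shift K).map_one_eq_zero
  leibniz' α β := Subtype.ext ((Hurwitz.shift K).leibniz (α : Hurwitz K) (β : Hurwitz K))

end Circ

end

end DRS

/-! ### The isomorphism between the finite dual and the differentially recursive sequences -/

theorem theorem2 (K : Type*) [Field K] [Differential K] :
    ∃ (Φ : DRS.UDual K ≃ₐ[K ⊗[DRS.constants K] K] DRS.Hurwitz K)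
      (ζ : DRS.Circ K →ₐ[K ⊗[DRS.constants K] K] DRS.UDual K)
      (D : Subalgebra (K ⊗[DRS.constants K] K) (DRS.Hurwitz K))
      (φ : DRS.Circ K ≃ₐ[K ⊗[DRS.constants K] K] D),
      -- `Φ` is `f ↦ (f(Yⁿ))ₙ`, `ζ` is the canonical map, `D` is the set of differentially recursive
      -- sequences, and `φ` is the restriction of `Φ` along `ζ`
      (∀ f : DRS.UDual K, Φ f = DRS.UDual.toHurwitz f) ∧
      (∀ a : DRS.Circ K, ζ a = DRS.Circ.zeta K a) ∧
      (D : Set (DRS.Hurwitz K)) = DRS.Dlin K ∧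
      (∀ a : DRS.Circ K, (φ a : DRS.Hurwitz K) = Φ (ζ a)) ∧
      -- the formula for `φ`
      (∀ (M : DRS.DiffMod K) (f : Module.Dual K M) (m : M) (n : ℕ),
        (φ (DRS.Circ.mk M f m) : DRS.Hurwitz K).coeff n = f (M.der^[n] m)) ∧
      -- the formula for the inverse: `P U` is a finite-codimensional right ideal on which
      -- `f_α = Φ⁻¹(α)` vanishes, and `φ⁻¹(α)` is the class of `f̃_α ⊗ 1`
      (∀ (α : D) (d : ℕ) (c : ℕ → K), c d ≠ 0 → DRS.Hurwitz.operator d c (α : DRS.Hurwitz K) = 0 →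
        ∃ (hP : Module.Finite K
              (DRS.DiffOp K ⧸ LinearMap.range (DRS.DiffOp.ofCoeffs d c).lmul))
          (f' : Module.Dual K
              (DRS.DiffOp K ⧸ LinearMap.range (DRS.DiffOp.ofCoeffs d c).lmul)),
          (∀ u : DRS.DiffOp K, f' (Submodule.Quotient.mk u) = (Φ.symm (α : DRS.Hurwitz K)) u) ∧
          φ.symm α = DRS.Circ.mk (DRS.DiffMod.cyclic (DRS.DiffOp.ofCoeffs d c) hP) f'
            (Submodule.Quotient.mk 1)) ∧
      -- the shift restricts to a derivation of `D`, and `φ` commutes with the derivations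
      ∃ N : Derivation K D D,
        (∀ α : D, (N α : DRS.Hurwitz K) = DRS.Hurwitz.shift K (α : DRS.Hurwitz K)) ∧
        ∀ a : DRS.Circ K, φ (DRS.Circ.der K a) = N (φ a) := by
  refine ⟨DRS.UDual.toHurwitzAlgEquiv K, DRS.Circ.zetaAlgHom K,
    (DRS.Circ.toHurwitzAlgHom K).range,
    AlgEquiv.ofInjective (DRS.Circ.toHurwitzAlgHom K) DRS.Circ.toHurwitzAlgHom_injective,
    fun _ => rfl, fun _ => rfl, DRS.Circ.coe_range_toHurwitzAlgHom, fun _ => rfl,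
    DRS.Circ.toHurwitz_zeta_mk_coeff, ?_, DRS.Circ.shiftRange K, fun _ => rfl,
    fun a => Subtype.ext (DRS.Circ.toHurwitz_zeta_der a)⟩
  intro α d c hc h
  obtain ⟨f, hf⟩ := (DRS.UDual.toHurwitzAlgEquiv K).surjective (α : DRS.Hurwitz K)
  rw [← hf] at h ⊢
  have hP := (DRS.UDual.operator_eq_zero_iff d c f).1 h
  refine ⟨DRS.DiffMod.finite_quotient_ofCoeffs d c hc, DRS.Circ.descend _ f hP, fun u => ?_, ?_⟩
  · rw [AlgEquiv.symm_apply_apply]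
    rfl
  · rw [AlgEquiv.symm_apply_eq]
    refine Subtype.ext (hf.symm.trans ?_)
    exact congrArg DRS.UDual.toHurwitz (DRS.Circ.zeta_mk_cyclic _ _ f hP).symm
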